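/- **Setting.** Let $a,\tau>0$, let $b,c:[0,1]\to\mathbb R$ be $C^2$, and put $$X^{s}(\lambda)=\tfrac12 b(\lambda)+\tfrac12\sqrt{b(\lambda)^2-4c(\lambda)},\qquad X^{u}(\lambda)=\tfrac12 b(\lambda)-\tfrac12\sqrt{b(\lambda)^2-4c(\lambda)}$$ wherever $b^2\ge 4c$. Let $\mathcal P(0,1)$ be the set of $C^2$ functions $\Lambda:\mathbb R\to(0,1)$ with $\Lambda(s)\to 0$ as $s\to-\infty$, $\Lambda(s)\to 1$ as $s\to+\infty$ and $\Lambda'(s)\to0$ as $s\to\pm\infty$. Let $\dot x=f(x,\lambda)$ be either 1. the reduced energy-balance model $\dot X=-X^2+b(\lambda)X-c(\lambda)$, with $S(\lambda)=X^s(\lambda)$; or 2. the Fraedrich model $\dot T=\tau^{-1}a\,(-T^4+b(\lambda)T^2-c(\lambda))$ (where $X=T^2$), with $S(\lambda)=\sqrt{X^s(\lambda)}$, assuming that $X^u(\lambda)>0$ for every $\lambda\in[0,1]$ with $b(\lambda)^2\ge4c(\lambda)$. **Trajectories.** For $\Lambda\in\mathcal P(0,1)$ and $r>0$, trajectories of $\dot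 x=f(x,\Lambda(rt))$ are taken in $[-\infty,\infty)$: a solution that runs off to $-\infty$ in finite time stays at $-\infty$ from then on. A trajectory is defined for all $t\in\mathbb R$. **Equilibria.** The *equilibria* are the pairs $(x,\lambda)$ with $\lambda\in[0,1]$ and either $x\in\mathbb R$, $f(x,\lambda)=0$, or $x=-\infty$. An equilibrium with $x\in\mathbb R$ is *stable* if $\partial_xf(x,\lambda)<0$ and a *bifurcation equilibrium* if $\partial_xf(x,\lambda)=0$; $(-\infty,\lambda)$ is stable if $f(x,\lambda)<0$ for all $x$ near $-\infty$. A *stable branch* on $[0,1]$ is a real $C^2$ curve $\lambda\mapsto(X(\lambda),\lambda)$ of equilibria in the closure of the set of stable ones that meets no bifurcation equilibrium for $0<\lambda<1$. For stable $(X_-,0)$ and $(X_+,1)$, the points $X_-,X_+$ are *$\Lambda$-connected* if there is a continuous $X:\mathbb R\to[-\infty,\infty)$ with $X(s)\to X_\pm$ as $s\to\pm\infty$ such that every $(X(s),\Lambda(s))$ is an equilibrium in the closure of the set of stable ones. **Tipping.** Let $(X_-,0)$ be stable, and let $x^{[r]}$ be the trajectory with $x^{[r]}(t)\to X_-$ as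 $t\to-\infty$ (the pullback attractor). * There is *B-tipping* from $X_-$ for $\Lambda$ if there is a stable $(X_+,1)$, with $X_+$ not $\Lambda$-connected to $X_-$, such that $x^{[r]}(t)\to X_+$ as $t\to\infty$ for all sufficiently small $r>0$. * There is *irreversible R-tipping* from $X_-$ on $\Lambda$ if there are $r_0>0$, an $X_+$ that is $\Lambda$-connected to $X_-$, and $Y_+\ne X_+$ such that, as $t\to\infty$, $x^{[r]}(t)\to X_+$ for $0<r<r_0$ and $x^{[r_0]}(t)\to Y_+$. **Theorem.** In both cases 1 and 2, if $b(0)^2>4c(0)$ then $(S(0),0)$ is stable, and for all $\Lambda\in\mathcal P(0,1)$ and $r>0$ exactly one trajectory tends to $S(0)$ as $t\to-\infty$. Moreover: * **(a)** If $b(\lambda)^2>4c(\lambda)$ for all $\lambda\in[0,1]$, then $S$ is a stable branch from $S(0)$ to $S(1)$, and there is no B-tipping from $S(0)$ for any $\Lambda\in\mathcal P(0,1)$. * **(b)** If moreover $X^s(\mu)>X^u(\nu)$ for all $\mu,\nu\in[0,1]$, then there is no irreversible R-tipping from $S(0)$ on any $\Lambda\in\mathcal P(0,1)$. * **(c)**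 If the hypothesis of (a) holds and $X^s(\mu)<X^u(\nu)$ for some $0<\mu<\nu<1$, then there is a $\Lambda\in\mathcal P(0,1)$ with irreversible R-tipping from $S(0)$. * **(d)** If the hypothesis of (a) holds and $X^s(0)<X^u(1)$, then there is a $\Lambda\in\mathcal P(0,1)$ with irreversible R-tipping from $S(0)$. * **(e)** If $b(0)^2>4c(0)$ and $b(\mu)^2<4c(\mu)$ for some $0<\mu<1$, then there is B-tipping from $S(0)$ for every $\Lambda\in\mathcal P(0,1)$. -/

import Mathlib

open Filter Topology Set

namespace Tipping

/-- The class `𝒫(lm, lp)` of parameter shifts: `C²` functions with values in `(lm, lp)`, tending to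
`lm` and `lp` at `-∞` and `+∞`, with derivative tending to `0` at both ends. -/
structure IsParameterShift (lm lp : ℝ) (Λ : ℝ → ℝ) : Prop where
  contDiff : ContDiff ℝ 2 Λ
  mem_Ioo : ∀ s, Λ s ∈ Ioo lm lp
  tendsto_atBot : Tendsto Λ atBot (𝓝 lm)
  tendsto_atTop : Tendsto Λ atTop (𝓝 lp)
  deriv_atBot : Tendsto (deriv Λ) atBot (𝓝 0)
  deriv_atTop : Tendsto (deriv Λ) atTop (𝓝 0)

/-- Trajectories of `dx/dt = f (x, Λ (r t))` on the extended state space `[-∞, ∞)`. A solution that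
runs off to `-∞` in finite time is continued by the absorbing state `⊥ = -∞` (this makes the
forward evolution defined for all times). Wherever the state is finite the equation holds in the
classical sense; the state `⊥` is only reached continuously, and is never left. -/
structure IsTrajectory (f : ℝ → ℝ → ℝ) (Λ : ℝ → ℝ) (r : ℝ) (x : ℝ → EReal) : Prop where
  ne_top : ∀ t, x t ≠ ⊤
  continuous : Continuous x
  hasDerivAt : ∀ t, x t ≠ ⊥ →
    HasDerivAt (fun u => (x u).toReal) (f (x t).toReal (Λ (r * t))) t
  absorbing : ∀ s t, s ≤ t → x s = ⊥ → x t = ⊥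

/-- The pullback attractor with past limit `Xm`: the trajectory that tends to `Xm` as `t → -∞`. -/
def IsPullbackTrajectory (f : ℝ → ℝ → ℝ) (Λ : ℝ → ℝ) (r : ℝ) (Xm : EReal) (x : ℝ → EReal) : Prop :=
  IsTrajectory f Λ r x ∧ Tendsto x atBot (𝓝 Xm)

/-- The pullback attractor with past limit `Xm` has the future limit `Y`. -/
def PullbackLimit (f : ℝ → ℝ → ℝ) (Λ : ℝ → ℝ) (r : ℝ) (Xm Y : EReal) : Prop :=
  ∃ x, IsPullbackTrajectory f Λ r Xm x ∧ Tendsto x atTop (𝓝 Y)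

/-- The set of equilibria `(x, l)`, `lm ≤ l ≤ lp`, of the frozen systems `dx/dt = f (x, l)` on
`[-∞, ∞)`: the zeros of `f`, and the rest state `⊥`. -/
def equilibria (f : ℝ → ℝ → ℝ) (lm lp : ℝ) : Set (EReal × ℝ) :=
  {p | p.2 ∈ Icc lm lp ∧ ((∃ y : ℝ, p.1 = (y : EReal) ∧ f y p.2 = 0) ∨ p.1 = ⊥)}

/-- Stable equilibria: zeros of `f (·, l)` with negative linearization; and `⊥` when it is a sink,
that is, when `f (·, l)` is negative near `-∞`. -/
def stableEquilibria (f : ℝ → ℝ → ℝ) (lm lp : ℝ) : Set (EReal × ℝ) :=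
  {p | p.2 ∈ Icc lm lp ∧
    ((∃ y : ℝ, p.1 = (y : EReal) ∧ f y p.2 = 0 ∧ deriv (fun z => f z p.2) y < 0) ∨
      (p.1 = ⊥ ∧ ∀ᶠ y in atBot, f y p.2 < 0))}

/-- Bifurcation equilibria: zeros of `f (·, l)` with zero linearization. -/
def bifurcationEquilibria (f : ℝ → ℝ → ℝ) (lm lp : ℝ) : Set (EReal × ℝ) :=
  {p | p.2 ∈ Icc lm lp ∧
    ∃ y : ℝ, p.1 = (y : EReal) ∧ f y p.2 = 0 ∧ deriv (fun z => f z p.2) y = 0}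

/-- `X` is a stable branch over `[lm, lp]`: a `C²` curve of equilibria which meets no bifurcation
equilibrium except possibly at its end points, contained in the closure of the stable set. -/
structure IsStableBranch (f : ℝ → ℝ → ℝ) (lm lp : ℝ) (X : ℝ → ℝ) : Prop where
  contDiffOn : ContDiffOn ℝ 2 X (Icc lm lp)
  mem_equilibria : ∀ l ∈ Icc lm lp, ((X l : EReal), l) ∈ equilibria f lm lp
  notMem_bifurcation : ∀ l ∈ Ioo lm lp, ((X l : EReal), l) ∉ bifurcationEquilibria f lm lp
  mem_closure : ∀ l ∈ Icc lm lp, ((X l : EReal), l) ∈ closure (stableEquilibria f lm lp)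

/-- `(X (s), Λ (s))` is a stable path from `(Xm, lm)` to `(Xp, lp)`. -/
structure IsStablePath (f : ℝ → ℝ → ℝ) (lm lp : ℝ) (Λ : ℝ → ℝ) (Xm Xp : EReal)
    (X : ℝ → EReal) : Prop where
  continuous : Continuous X
  tendsto_atBot : Tendsto X atBot (𝓝 Xm)
  tendsto_atTop : Tendsto X atTop (𝓝 Xp)
  mem_equilibria : ∀ s, (X s, Λ s) ∈ equilibria f lm lp
  mem_closure : ∀ s, (X s, Λ s) ∈ closure (stableEquilibria f lm lp)

/-- `(Xm, lm)` and `(Xp, lp)` are stable equilibria which are `Λ`-connected. -/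
def LambdaConnected (f : ℝ → ℝ → ℝ) (lm lp : ℝ) (Λ : ℝ → ℝ) (Xm Xp : EReal) : Prop :=
  (Xm, lm) ∈ stableEquilibria f lm lp ∧ (Xp, lp) ∈ stableEquilibria f lm lp ∧
    ∃ X, IsStablePath f lm lp Λ Xm Xp X

/-- B-tipping from `Xm` for the parameter shift `Λ`. -/
def BTipping (f : ℝ → ℝ → ℝ) (lm lp : ℝ) (Λ : ℝ → ℝ) (Xm : EReal) : Prop :=
  (Xm, lm) ∈ stableEquilibria f lm lp ∧
    ∃ Xp : EReal, (Xp, lp) ∈ stableEquilibria f lm lp ∧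
      (∃ r₀ > 0, ∀ r, 0 < r → r < r₀ → PullbackLimit f Λ r Xm Xp) ∧
      ¬ LambdaConnected f lm lp Λ Xm Xp

/-- Irreversible R-tipping from `Xm` on the parameter shift `Λ`. -/
def IrreversibleRTipping (f : ℝ → ℝ → ℝ) (lm lp : ℝ) (Λ : ℝ → ℝ) (Xm : EReal) : Prop :=
  (Xm, lm) ∈ stableEquilibria f lm lp ∧
    ∃ r₀ : ℝ, 0 < r₀ ∧ ∃ Xp : EReal, LambdaConnected f lm lp Λ Xm Xp ∧
      (∀ r, 0 < r → r < r₀ → PullbackLimit f Λ r Xm Xp) ∧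
      ∃ Yp : EReal, Yp ≠ Xp ∧ PullbackLimit f Λ r₀ Xm Yp

/-- The Fraedrich energy-balance model `dT/dt = τ⁻¹ a (-T⁴ + b T² - c)`. -/
noncomputable def fraedrich (a τ : ℝ) (b c : ℝ → ℝ) (T l : ℝ) : ℝ :=
  τ⁻¹ * a * (-T ^ 4 + b l * T ^ 2 - c l)

/-- The reduced energy-balance model `dX/dt = -X² + b X - c`, where `X = T²`. -/
def reduced (b c : ℝ → ℝ) (X l : ℝ) : ℝ :=
  -X ^ 2 + b l * X - c l

/-- The stable branch, in the variable `X = T²`. -/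
noncomputable def Xs (b c : ℝ → ℝ) (l : ℝ) : ℝ :=
  b l / 2 + √(b l ^ 2 - 4 * c l) / 2

/-- The unstable branch, in the variable `X = T²`. -/
noncomputable def Xu (b c : ℝ → ℝ) (l : ℝ) : ℝ :=
  b l / 2 - √(b l ^ 2 - 4 * c l) / 2

end Tipping

/-! In the variable `X` (with `X = T²` in the Fraedrich model) the field is a positive multiple of
`-(X - Xs)(X - Xu)`. So, as long as the discriminant is positive, states above the upper branch
fall, states between the branches rise, and states just below the lower one fall. Parts (a)-(d)
follow from this sign pattern, recorded in `IsBistable`, by scalar comparison: a graph along which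
the field exceeds the slope cannot be crossed downwards, and symmetrically.

The pullback attractor is a limit of solutions started at `S 0` at ever earlier times. Contraction
near `(S 0, 0)` lets `eventually_sub_le_pullback` compare attractors of nearby rates. At equal rates
this yields uniqueness; at different rates it shows that the rates which track the stable branch
form an open set. Slow rates always track (`tracking`), so B-tipping is impossible in (a). If one
constant level separates the branches, it is a barrier at every rate, whence (b).

If `S μ < U ν` with `μ < ν`, a shift that waits at `μ`, moves quickly to `ν` and waits there leaves
the state below all of `U`, and tracking fails at rate 1. The critical rate is the infimum of the
failing rates: it is positive because slow rates track, and it fails itself because tracking is an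
open condition. This is (c), and (d) reduces to it by continuity of the branches.

For (e), a negative discriminant gives `f y l ≤ -κ * (1 + y ^ 2)` near `μ`, so a slow passage sends
the state to `⊥` in finite time. No stable path connects `S 0` to `⊥`: it would equal `⊥` where the
shift passes `μ`, hence everywhere, because finite equilibria are bounded below. -/

namespace Tipping

/-! ### Barriers for extended real paths -/

section Barrier

/-- A lower barrier: a continuous extended real path which crosses the graph of `c` only upwards,
and starts above it, stays above it. -/
theorem lower_barrier {x : ℝ → EReal} (hx : Continuous x) {c c' : ℝ → ℝ} {t₀ t₁ : ℝ}
    (hc : ∀ t ∈ Icc t₀ t₁, HasDerivAt c (c' t) t)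
    (hcross : ∀ t ∈ Icc t₀ t₁, x t = c t →
      ∃ d, c' t < d ∧ HasDerivAt (fun u => (x u).toReal) d t)
    (h₀ : (c t₀ : EReal) ≤ x t₀) : ∀ t ∈ Icc t₀ t₁, (c t : EReal) ≤ x t := by
  intro t ht
  by_contra! hlt
  have hcc : ContinuousOn (fun u => (c u : EReal)) (Icc t₀ t) := fun u hu =>
    (continuous_coe_real_ereal.continuousAt.comp
      (hc u ⟨hu.1, hu.2.trans ht.2⟩).continuousAt).continuousWithinAt
  have hclosed : IsClosed {u ∈ Icc t₀ t | (c u : EReal) ≤ x u} :=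
    isClosed_Icc.isClosed_le hcc hx.continuousOn
  have hcomp : IsCompact {u ∈ Icc t₀ t | (c u : EReal) ≤ x u} :=
    isCompact_Icc.of_isClosed_subset hclosed (fun u hu => hu.1)
  -- `s` is the last time up to `t` at which the path is not below the graph. By continuity they
  -- meet at `s`, where the path is steeper, so it is above just after `s`: a contradiction.
  obtain ⟨s, ⟨hsI, hsle⟩, hsmax⟩ := hcomp.exists_isGreatest ⟨t₀, ⟨le_rfl, ht.1⟩, h₀⟩
  have hst : s < t := lt_of_le_of_ne hsI.2 (by rintro rfl; exact absurd hsle (not_le.2 hlt))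
  have hafter : ∀ u ∈ Ioc s t, x u < c u := by
    intro u hu
    by_contra! h
    exact absurd (hsmax ⟨⟨hsI.1.trans hu.1.le, hu.2⟩, h⟩) (not_le.2 hu.1)
  have hsI' : s ∈ Icc t₀ t₁ := ⟨hsI.1, hsI.2.trans ht.2⟩
  have hcs := hc s hsI'
  have hIoc : Ioc s t ∈ 𝓝[>] s := Ioc_mem_nhdsGT hst
  have heq : x s = c s := by
    refine le_antisymm ?_ hsle
    refine le_of_tendsto_of_tendsto (hx.continuousAt.tendsto.mono_left nhdsWithin_le_nhds)
      ((continuous_coe_real_ereal.continuousAt.comp hcs.continuousAt).tendsto.mono_left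
        nhdsWithin_le_nhds) (f := x) (b := 𝓝[>] s) ?_
    filter_upwards [hIoc] with u hu using (hafter u hu).le
  obtain ⟨d, hd, hder⟩ := hcross s hsI' heq
  have hsub : HasDerivAt (fun u => (x u).toReal - c u) (d - c' s) s := hder.sub hcs
  have hpos := (hasDerivWithinAt_iff_tendsto_slope' self_notMem_Ioi).1
    (hsub.hasDerivWithinAt (s := Ioi s))
  have hev := hpos.eventually (lt_mem_nhds (sub_pos.2 hd))
  -- The path is finite near `s`, so the derivative of `toReal` speaks about the extended order.
  have hne : ∀ᶠ u in 𝓝[>] s, x u ≠ ⊥ := by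
    have : ∀ᶠ u in 𝓝 s, x u ≠ ⊥ := by
      refine hx.continuousAt.eventually_ne ?_
      rw [heq]; exact EReal.coe_ne_bot _
    exact this.filter_mono nhdsWithin_le_nhds
  obtain ⟨u, hu, hun, huI⟩ := (hev.and (hne.and hIoc)).exists
  have hlt' := hafter u huI
  rw [slope_def_field] at hu
  have hus : 0 < u - s := sub_pos.2 huI.1
  have h0 : (x s).toReal - c s = 0 := by rw [heq]; simp
  rw [h0, sub_zero] at hu
  have h1 : 0 < (x u).toReal - c u := by
    have := (div_pos_iff_of_pos_right hus).1 hu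
    exact this
  have hnt : x u ≠ ⊤ := fun h => by rw [h] at hlt'; exact not_top_lt hlt'
  rw [← EReal.coe_toReal hnt hun, EReal.coe_lt_coe_iff] at hlt'
  linarith

/-- An upper barrier: a continuous extended real path which crosses the graph of `c` only
downwards, and starts below it, stays below it. -/
theorem upper_barrier {x : ℝ → EReal} (hx : Continuous x) {c c' : ℝ → ℝ} {t₀ t₁ : ℝ}
    (hc : ∀ t ∈ Icc t₀ t₁, HasDerivAt c (c' t) t)
    (hcross : ∀ t ∈ Icc t₀ t₁, x t = c t →
      ∃ d, d < c' t ∧ HasDerivAt (fun u => (x u).toReal) d t)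
    (h₀ : x t₀ ≤ (c t₀ : EReal)) : ∀ t ∈ Icc t₀ t₁, x t ≤ (c t : EReal) := by
  intro t ht
  have := lower_barrier (x := fun u => - x u) (continuous_neg.comp hx) (c := fun u => - c u)
    (c' := fun u => - c' u) (t₀ := t₀) (t₁ := t₁) (fun u hu => (hc u hu).neg) ?_ ?_ t ht
  · simpa [EReal.neg_le_neg_iff] using this
  · intro u hu h
    have h' : x u = c u := by
      have := congrArg (fun y => -y) h
      simpa using this
    obtain ⟨d, hd, hder⟩ := hcross u hu h'
    refine ⟨-d, by linarith, ?_⟩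
    simpa [EReal.toReal_neg] using! hder.neg
  · simpa [EReal.neg_le_neg_iff] using h₀

end Barrier

/-! ### Global solutions of bounded Lipschitz equations -/

section GlobalFlow

open scoped NNReal

/-- Exponential separation bound between two solutions of a Lipschitz scalar equation, forward and
backward in time. -/
theorem abs_sub_le_exp_mul {g : ℝ → ℝ → ℝ} {K : ℝ}
    (hg : ∀ t x y, |g t x - g t y| ≤ K * |x - y|) {z w : ℝ → ℝ}
    (hz : ∀ t, HasDerivAt z (g t (z t)) t) (hw : ∀ t, HasDerivAt w (g t (w t)) t) (s t : ℝ) :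
    |z t - w t| ≤ Real.exp (K * |t - s|) * |z s - w s| := by
  have hprod : ∀ u, |(z u - w u) * (g u (z u) - g u (w u))| ≤ K * (z u - w u) ^ 2 := by
    intro u
    rw [abs_mul, ← sq_abs]
    nlinarith [hg u (z u) (w u), abs_nonneg (z u - w u)]
  have hder : ∀ m u, HasDerivAt (fun v => (z v - w v) ^ 2 * Real.exp (m * v))
      ((2 * ((z u - w u) * (g u (z u) - g u (w u))) + m * (z u - w u) ^ 2) *
        Real.exp (m * u)) u := by
    intro m u
    have h1 := (((hz u).sub (hw u)).pow 2).mul (((hasDerivAt_id u).const_mul m).exp)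
    convert! h1 using 1
    simp; ring
  -- Grönwall in both time directions: the squared distance has derivative at most `2K` times itself
  -- in absolute value, so the weight `exp (2Kt)` makes it increase and `exp (-2Kt)` makes it
  -- decrease.
  have hmono : Monotone (fun v => (z v - w v) ^ 2 * Real.exp (2 * K * v)) := by
    refine monotone_of_hasDerivAt_nonneg (hder _) fun u => mul_nonneg ?_ (Real.exp_pos _).le
    have := abs_le.1 (hprod u)
    simp only; linarith [this.1]
  have hanti : Antitone (fun v => (z v - w v) ^ 2 * Real.exp (-(2 * K) * v)) := by
    refine antitone_of_hasDerivAt_nonpos (hder _) fun u =>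
      mul_nonpos_of_nonpos_of_nonneg ?_ (Real.exp_pos _).le
    have := abs_le.1 (hprod u)
    simp only; linarith [this.2]
  have hsq : (z t - w t) ^ 2 ≤ (Real.exp (K * |t - s|) * |z s - w s|) ^ 2 := by
    rw [mul_pow, sq_abs, ← Real.exp_nat_mul]
    rcases le_total s t with h | h
    · have h2 := hanti h
      simp only at h2
      rw [abs_of_nonneg (sub_nonneg.2 h)]
      calc (z t - w t) ^ 2
          = (z t - w t) ^ 2 * Real.exp (-(2 * K) * t) * Real.exp (2 * K * t) := by
            rw [mul_assoc, ← Real.exp_add]; ring_nf; simp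
        _ ≤ (z s - w s) ^ 2 * Real.exp (-(2 * K) * s) * Real.exp (2 * K * t) := by gcongr
        _ = _ := by rw [mul_assoc, ← Real.exp_add, mul_comm]; congr 2; push_cast; ring
    · have h2 := hmono h
      simp only at h2
      rw [abs_of_nonpos (sub_nonpos.2 h)]
      calc (z t - w t) ^ 2
          = (z t - w t) ^ 2 * Real.exp (2 * K * t) * Real.exp (-(2 * K) * t) := by
            rw [mul_assoc, ← Real.exp_add]; ring_nf; simp
        _ ≤ (z s - w s) ^ 2 * Real.exp (2 * K * s) * Real.exp (-(2 * K) * t) := by gcongr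
        _ = _ := by rw [mul_assoc, ← Real.exp_add, mul_comm]; congr 2; push_cast; ring
  exact abs_le_of_sq_le_sq hsq (by positivity)

/-- A bounded scalar field, Lipschitz in space and continuous in time, has global solutions. -/
theorem exists_global_solution {g : ℝ → ℝ → ℝ} {K B : ℝ≥0} (hg : ∀ t, LipschitzWith K (g t))
    (hB : ∀ t x, |g t x| ≤ B) (hcont : ∀ x, Continuous fun t => g t x) (t₀ ξ : ℝ) :
    ∃ z : ℝ → ℝ, z t₀ = ξ ∧ ∀ t, HasDerivAt z (g t (z t)) t := by
  have hloc : ∀ n : ℕ, ∃ z : ℝ → ℝ, z t₀ = ξ ∧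
      ∀ t ∈ Ioo (t₀ - (n + 1)) (t₀ + (n + 1)), HasDerivAt z (g t (z t)) t := by
    intro n
    have hmem : t₀ ∈ Icc (t₀ - (n + 1)) (t₀ + (n + 1)) :=
      ⟨by linarith [n.cast_nonneg (α := ℝ)], by linarith [n.cast_nonneg (α := ℝ)]⟩
    -- Speed at most `B` over a time `n + 1` covers at most `B * (n + 1)`. With this radius
    -- Picard–Lindelöf works on an interval of any length.
    have hPL : IsPicardLindelof g (⟨t₀, hmem⟩ : Icc (t₀ - (n + 1)) (t₀ + (n + 1))) ξ
        (B * (n + 1)) 0 B K :=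
      { lipschitzOnWith := fun t _ => (hg t).lipschitzOnWith
        continuousOn := fun x _ => (hcont x).continuousOn
        norm_le := fun t _ x _ => hB t x
        mul_max_le := by simp }
    obtain ⟨z, hz, hz'⟩ := hPL.exists_eq_forall_mem_Icc_hasDerivWithinAt₀
    exact ⟨z, hz, fun t ht => (hz' t (Ioo_subset_Icc_self ht)).hasDerivAt (Icc_mem_nhds ht.1 ht.2)⟩
  choose z hz hz' using hloc
  have hagree : ∀ m n : ℕ, m ≤ n → EqOn (z m) (z n) (Ioo (t₀ - (m + 1)) (t₀ + (m + 1))) := by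
    intro m n hmn
    have hmn' : (m : ℝ) ≤ n := by exact_mod_cast hmn
    refine ODE_solution_unique_of_mem_Ioo (v := g) (s := fun _ => univ) (K := K)
      (fun t _ => (hg t).lipschitzOnWith) (t₀ := t₀) ?_ (fun t ht => ⟨hz' m t ht, trivial⟩)
      (fun t ht => ⟨hz' n t ⟨by linarith [ht.1], by linarith [ht.2]⟩, trivial⟩)
      ((hz m).trans (hz n).symm)
    constructor <;> linarith [m.cast_nonneg (α := ℝ)]
  -- The solution of index `n` lives on half-length `n + 1`, so index `⌈|t - t₀|⌉₊` has `t` in the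
  -- interior. One index more covers a neighbourhood of `t`, on which all the indices in use agree.
  refine ⟨fun t => z ⌈|t - t₀|⌉₊ t, by simp [hz], fun t => ?_⟩
  set n := ⌈|t - t₀|⌉₊ + 1 with hn
  have hmemI : ∀ (u : ℝ) (k : ℕ), |u - t₀| < k + 1 → u ∈ Ioo (t₀ - (k + 1)) (t₀ + (k + 1)) := by
    intro u k h
    rw [abs_lt] at h
    constructor <;> linarith [h.1, h.2]
  have heq : (fun u => z ⌈|u - t₀|⌉₊ u) =ᶠ[𝓝 t] z n := by
    have : ∀ᶠ u in 𝓝 t, |u - t₀| < n := by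
      refine (Continuous.tendsto (by fun_prop : Continuous fun u => |u - t₀|) t).eventually_lt_const ?_
      push_cast [hn]
      linarith [Nat.le_ceil |t - t₀|]
    filter_upwards [this] with u hu
    refine hagree _ _ (Nat.ceil_le.2 hu.le) (hmemI u _ ?_)
    linarith [Nat.le_ceil |u - t₀|]
  have hd := hz' n t (hmemI t n (by push_cast [hn]; linarith [Nat.le_ceil |t - t₀|]))
  have h2 := hd.congr_of_eventuallyEq heq
  have h3 := heq.self_of_nhds
  simp only at h3
  rwa [← h3] at h2

end GlobalFlow

/-! ### Regular fields and their uniform estimates -/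

/-- The standing regularity assumptions on the right-hand side `f` over the parameter interval
`[0, 1]`: it is `C¹` in the state with jointly continuous derivative `f'`, it is negative for all
large states, and its zeros are nowhere dense. -/
structure IsRegularField (f f' : ℝ → ℝ → ℝ) : Prop where
  hasDerivAt : ∀ l ∈ Icc (0 : ℝ) 1, ∀ x, HasDerivAt (fun y => f y l) (f' x l) x
  continuousOn : ContinuousOn (fun p : ℝ × ℝ => f p.1 p.2) (univ ×ˢ Icc (0 : ℝ) 1)
  continuousOn' : ContinuousOn (fun p : ℝ × ℝ => f' p.1 p.2) (univ ×ˢ Icc (0 : ℝ) 1)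
  neg_of_large : ∃ M > 0, ∀ l ∈ Icc (0 : ℝ) 1, ∀ x, M ≤ |x| → f x l < 0
  exists_ne_zero : ∀ l ∈ Icc (0 : ℝ) 1, ∀ p q : ℝ, p < q → ∃ x ∈ Ioo p q, f x l ≠ 0

namespace IsParameterShift

variable {Λ : ℝ → ℝ}

theorem mem_Icc (hΛ : IsParameterShift 0 1 Λ) (s : ℝ) : Λ s ∈ Icc (0 : ℝ) 1 :=
  Ioo_subset_Icc_self (hΛ.mem_Ioo s)

theorem tendsto_mul_atBot (hΛ : IsParameterShift 0 1 Λ) {r : ℝ} (hr : 0 < r) :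
    Tendsto (fun t => Λ (r * t)) atBot (𝓝[Icc 0 1] 0) :=
  tendsto_nhdsWithin_iff.2 ⟨hΛ.tendsto_atBot.comp (tendsto_id.const_mul_atBot hr),
    Eventually.of_forall fun _ => hΛ.mem_Icc _⟩

theorem tendsto_mul_atTop (hΛ : IsParameterShift 0 1 Λ) {r : ℝ} (hr : 0 < r) :
    Tendsto (fun t => Λ (r * t)) atTop (𝓝[Icc 0 1] 1) :=
  tendsto_nhdsWithin_iff.2 ⟨hΛ.tendsto_atTop.comp (tendsto_id.const_mul_atTop hr),
    Eventually.of_forall fun _ => hΛ.mem_Icc _⟩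

theorem continuous (hΛ : IsParameterShift 0 1 Λ) : Continuous Λ := hΛ.contDiff.continuous

end IsParameterShift

namespace IsRegularField

variable {f f' : ℝ → ℝ → ℝ}

theorem exists_bound (hf : IsRegularField f f') (N : ℝ) :
    ∃ B > 0, ∀ l ∈ Icc (0 : ℝ) 1, ∀ x ∈ Icc (-N) N, |f x l| ≤ B := by
  obtain ⟨B, hB⟩ := ((isCompact_Icc (a := -N) (b := N)).prod (isCompact_Icc (a := (0 : ℝ))
    (b := 1))).exists_bound_of_continuousOn
    (hf.continuousOn.mono (prod_mono (subset_univ _) subset_rfl))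
  exact ⟨max B 1, by positivity, fun l hl x hx => (hB (x, l) ⟨hx, hl⟩).trans (le_max_left _ _)⟩

theorem exists_lipschitz (hf : IsRegularField f f') (N : ℝ) :
    ∃ K > 0, ∀ l ∈ Icc (0 : ℝ) 1, ∀ x ∈ Icc (-N) N, ∀ y ∈ Icc (-N) N,
      |f x l - f y l| ≤ K * |x - y| := by
  obtain ⟨B, hB⟩ := ((isCompact_Icc (a := -N) (b := N)).prod (isCompact_Icc (a := (0 : ℝ))
    (b := 1))).exists_bound_of_continuousOn
    (hf.continuousOn'.mono (prod_mono (subset_univ _) subset_rfl))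
  refine ⟨max B 1, by positivity, fun l hl x hx y hy => ?_⟩
  exact (convex_Icc (-N) N).norm_image_sub_le_of_norm_hasDerivWithin_le
    (fun u _ => (hf.hasDerivAt l hl u).hasDerivWithinAt)
    (fun u hu => (hB (u, l) ⟨hu, hl⟩).trans (le_max_left _ _)) hy hx

/-- Near a linearly stable equilibrium the field is uniformly contracting. -/
theorem exists_contraction (hf : IsRegularField f f') {S₀ l₀ : ℝ} (hl₀ : l₀ ∈ Icc (0 : ℝ) 1)
    (hneg : f' S₀ l₀ < 0) :
    ∃ ε > 0, ∃ κ > 0, ∀ᶠ l in 𝓝[Icc 0 1] l₀, ∀ x ∈ Icc (S₀ - ε) (S₀ + ε),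
      ∀ y ∈ Icc (S₀ - ε) (S₀ + ε), x ≤ y → f y l - f x l ≤ -κ * (y - x) := by
  have hcw : ContinuousWithinAt (fun p : ℝ × ℝ => f' p.1 p.2) (univ ×ˢ Icc (0 : ℝ) 1) (S₀, l₀) :=
    hf.continuousOn' _ ⟨trivial, hl₀⟩
  -- Half of the linear decay rate survives on a product neighbourhood; the mean value inequality
  -- turns it into `κ`.
  have hev : ∀ᶠ p in 𝓝[univ ×ˢ Icc (0 : ℝ) 1] (S₀, l₀), f' p.1 p.2 < f' S₀ l₀ / 2 :=
    hcw.tendsto.eventually_lt_const (by simp only; linarith)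
  rw [nhdsWithin_prod_eq, nhdsWithin_univ] at hev
  obtain ⟨U, hU, V, hV, h⟩ := Filter.eventually_prod_iff.1 hev
  obtain ⟨ε, hε, hball⟩ := Metric.nhds_basis_closedBall.eventually_iff.1 hU
  rw [Real.closedBall_eq_Icc] at hball
  refine ⟨ε, hε, -(f' S₀ l₀ / 2), by linarith, ?_⟩
  filter_upwards [hV, self_mem_nhdsWithin] with l hl hlI x hx y hy hxy
  have := (convex_Icc (S₀ - ε) (S₀ + ε)).image_sub_le_mul_sub_of_deriv_le
    (f := fun u => f u l) (C := f' S₀ l₀ / 2)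
    (fun u _ => (hf.hasDerivAt l hlI u).continuousAt.continuousWithinAt)
    (fun u _ => (hf.hasDerivAt l hlI u).differentiableAt.differentiableWithinAt)
    (fun u hu => by
      rw [(hf.hasDerivAt l hlI u).deriv]
      exact (h (hball (interior_subset hu)) hl).le) x hx y hy hxy
  linarith

theorem continuousOn_param (hf : IsRegularField f f') (x : ℝ) :
    ContinuousOn (fun l => f x l) (Icc 0 1) :=
  hf.continuousOn.comp (f := fun l : ℝ => (x, l)) (by fun_prop) fun _ hl => ⟨trivial, hl⟩

theorem tendsto_field (hf : IsRegularField f f') {ι : Type*} {m : Filter ι} {u v : ι → ℝ}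
    {L l₀ : ℝ} (hl₀ : l₀ ∈ Icc (0 : ℝ) 1) (hu : Tendsto u m (𝓝 L))
    (hv : Tendsto v m (𝓝[Icc 0 1] l₀)) : Tendsto (fun i => f (u i) (v i)) m (𝓝 (f L l₀)) := by
  have hcw : ContinuousWithinAt (fun p : ℝ × ℝ => f p.1 p.2) (univ ×ˢ Icc (0 : ℝ) 1) (L, l₀) :=
    hf.continuousOn _ ⟨trivial, hl₀⟩
  have h := hcw.tendsto
  rw [nhdsWithin_prod_eq, nhdsWithin_univ] at h
  exact h.comp (hu.prodMk hv)

end IsRegularField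

/-! ### Trajectories: comparison and limits -/

namespace IsTrajectory

variable {f f' : ℝ → ℝ → ℝ} {Λ : ℝ → ℝ} {r : ℝ} {x : ℝ → EReal}

theorem hasDerivAt_of_eq_coe (hx : IsTrajectory f Λ r x) {t y : ℝ} (h : x t = y) :
    HasDerivAt (fun u => (x u).toReal) (f y (Λ (r * t))) t := by
  simpa [h] using hx.hasDerivAt t (by simp [h])

theorem le_of_lower_barrier (hx : IsTrajectory f Λ r x) {c c' : ℝ → ℝ} {t₀ t₁ : ℝ}
    (hc : ∀ t ∈ Icc t₀ t₁, HasDerivAt c (c' t) t)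
    (hlt : ∀ t ∈ Icc t₀ t₁, c' t < f (c t) (Λ (r * t)))
    (h₀ : (c t₀ : EReal) ≤ x t₀) : ∀ t ∈ Icc t₀ t₁, (c t : EReal) ≤ x t :=
  lower_barrier hx.continuous hc
    (fun t ht h => ⟨_, hlt t ht, hx.hasDerivAt_of_eq_coe h⟩) h₀

theorem le_of_upper_barrier (hx : IsTrajectory f Λ r x) {c c' : ℝ → ℝ} {t₀ t₁ : ℝ}
    (hc : ∀ t ∈ Icc t₀ t₁, HasDerivAt c (c' t) t)
    (hlt : ∀ t ∈ Icc t₀ t₁, f (c t) (Λ (r * t)) < c' t)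
    (h₀ : x t₀ ≤ (c t₀ : EReal)) : ∀ t ∈ Icc t₀ t₁, x t ≤ (c t : EReal) :=
  upper_barrier hx.continuous hc
    (fun t ht h => ⟨_, hlt t ht, hx.hasDerivAt_of_eq_coe h⟩) h₀

theorem const_le (hx : IsTrajectory f Λ r x) {p t₀ t₁ : ℝ} (h : t₀ ≤ t₁)
    (hp : ∀ t ∈ Icc t₀ t₁, 0 < f p (Λ (r * t))) (h₀ : (p : EReal) ≤ x t₀) : (p : EReal) ≤ x t₁ :=
  hx.le_of_lower_barrier (c := fun _ => p) (c' := fun _ => 0) (fun t _ => hasDerivAt_const t p)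
    hp h₀ t₁ ⟨h, le_rfl⟩

theorem le_const (hx : IsTrajectory f Λ r x) {p t₀ t₁ : ℝ} (h : t₀ ≤ t₁)
    (hp : ∀ t ∈ Icc t₀ t₁, f p (Λ (r * t)) < 0) (h₀ : x t₀ ≤ (p : EReal)) : x t₁ ≤ (p : EReal) :=
  hx.le_of_upper_barrier (c := fun _ => p) (c' := fun _ => 0) (fun t _ => hasDerivAt_const t p)
    hp h₀ t₁ ⟨h, le_rfl⟩

/-- Every trajectory has a limit in `[-∞, ∞]` at either end of the time axis. -/
theorem exists_tendsto (hf : IsRegularField f f')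
    (hx : IsTrajectory f Λ r x) {m : Filter ℝ} (hm : m = atTop ∨ m = atBot) {l₀ : ℝ}
    (hl₀ : l₀ ∈ Icc (0 : ℝ) 1) (hlim : Tendsto (fun t => Λ (r * t)) m (𝓝[Icc 0 1] l₀)) :
    ∃ L, Tendsto x m (𝓝 L) := by
  have hpair : ∀ {P Q E : ℝ → Prop}, (∃ᶠ t in m, P t) → (∃ᶠ t in m, Q t) → (∀ᶠ t in m, E t) →
      ∃ s t, s ≤ t ∧ P s ∧ Q t ∧ ∀ u ∈ Icc s t, E u := by
    intro P Q E hP hQ hE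
    rcases hm with rfl | rfl
    · obtain ⟨T, hT⟩ := eventually_atTop.1 hE
      obtain ⟨s, hs, hPs⟩ := frequently_atTop.1 hP T
      obtain ⟨t, ht, hQt⟩ := frequently_atTop.1 hQ s
      exact ⟨s, t, ht, hPs, hQt, fun u hu => hT u (hs.trans hu.1)⟩
    · obtain ⟨T, hT⟩ := eventually_atBot.1 hE
      obtain ⟨t, ht, hQt⟩ := frequently_atBot.1 hQ T
      obtain ⟨s, hs, hPs⟩ := frequently_atBot.1 hP t
      exact ⟨s, t, hs, hPs, hQt, fun u hu => hT u (hu.2.trans ht)⟩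
  -- An oscillating trajectory would cross some level `y` with `f y l₀ ≠ 0` infinitely often in both
  -- directions. But the field at `y` finally has a constant sign, which allows only one direction.
  refine tendsto_of_no_upcrossings dense_univ ?_
  rintro p - q - hpq ⟨hp, hq⟩
  obtain ⟨p', hpp', hp'q⟩ := EReal.lt_iff_exists_real_btwn.1 hpq
  obtain ⟨q', hpq', hq'q⟩ := EReal.lt_iff_exists_real_btwn.1 hp'q
  obtain ⟨y, hy, hy0⟩ := hf.exists_ne_zero l₀ hl₀ p' q' (EReal.coe_lt_coe_iff.1 hpq')
  have hpy : p ≤ (y : EReal) := (hpp'.trans (EReal.coe_lt_coe_iff.2 hy.1)).le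
  have hyq : (y : EReal) < q := (EReal.coe_lt_coe_iff.2 hy.2).trans hq'q
  have ht := (hf.tendsto_field hl₀ (tendsto_const_nhds (x := y)) hlim)
  rcases lt_or_gt_of_ne hy0 with h | h
  · obtain ⟨s, t, hst, hs, ht', hE⟩ := hpair hp hq (ht.eventually_lt_const h)
    exact absurd (hx.le_const hst hE (hs.le.trans hpy)) (not_le.2 (hyq.trans ht'))
  · obtain ⟨s, t, hst, hs, ht', hE⟩ := hpair hq hp (ht.eventually_const_lt h)
    exact absurd (hx.const_le hst hE (hyq.le.trans hs.le)) (not_le.2 (ht'.trans_le hpy))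

/-- A finite limit of a trajectory is an equilibrium of the limiting system. -/
theorem limit_eq_zero (hf : IsRegularField f f') (hx : IsTrajectory f Λ r x)
    {m : Filter ℝ} (hm : m = atTop ∨ m = atBot) {l₀ L : ℝ}
    (hl₀ : l₀ ∈ Icc (0 : ℝ) 1) (hlim : Tendsto (fun t => Λ (r * t)) m (𝓝[Icc 0 1] l₀))
    (hL : Tendsto x m (𝓝 (L : EReal))) : f L l₀ = 0 := by
  have hreal : Tendsto (fun t => (x t).toReal) m (𝓝 L) := by
    simpa using! (EReal.tendsto_toReal (EReal.coe_ne_top L) (EReal.coe_ne_bot L)).comp hL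
  have hadd : Tendsto (fun t : ℝ => t + 1) m m := by
    rcases hm with rfl | rfl
    · exact tendsto_atTop_add_const_right _ _ tendsto_id
    · exact tendsto_atBot_add_const_right _ _ tendsto_id
  have hne : ∀ᶠ t in m, ∀ u ∈ Icc t (t + 1), x u ≠ ⊥ := by
    have h := hL.eventually_ne (EReal.coe_ne_bot L)
    rcases hm with rfl | rfl
    · obtain ⟨T, hT⟩ := eventually_atTop.1 h
      filter_upwards [eventually_ge_atTop T] with t ht u hu using hT u (ht.trans hu.1)
    · obtain ⟨T, hT⟩ := eventually_atBot.1 h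
      filter_upwards [eventually_le_atBot (T - 1)] with t ht u hu
      exact hT u (by linarith [hu.2])
  -- The increment over a unit of time is a value of the field at an intermediate time. It tends to
  -- `0` since the trajectory converges, while the field tends to `f L l₀`.
  have hmvt : ∀ t, ∃ ξ ∈ Icc t (t + 1), (∀ u ∈ Icc t (t + 1), x u ≠ ⊥) →
      f (x ξ).toReal (Λ (r * ξ)) = (x (t + 1)).toReal - (x t).toReal := by
    intro t
    by_cases h : ∀ u ∈ Icc t (t + 1), x u ≠ ⊥
    · obtain ⟨ξ, hξ, he⟩ := exists_hasDerivAt_eq_slope (fun u => (x u).toReal)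
        (fun u => f (x u).toReal (Λ (r * u))) (by linarith : t < t + 1)
        (fun u hu => (hx.hasDerivAt u (h u hu)).continuousAt.continuousWithinAt)
        (fun u hu => hx.hasDerivAt u (h u (Ioo_subset_Icc_self hu)))
      exact ⟨ξ, Ioo_subset_Icc_self hξ, fun _ => by rw [he]; simp⟩
    · exact ⟨t, ⟨le_rfl, by linarith⟩, fun h' => absurd h' h⟩
  choose ξ hξ he using hmvt
  have hξm : Tendsto ξ m m := by
    rcases hm with rfl | rfl
    · exact tendsto_atTop_mono (fun t => (hξ t).1) tendsto_id
    · exact tendsto_atBot_mono (fun t => (hξ t).2) hadd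
  have h1 := hf.tendsto_field hl₀ (hreal.comp hξm) (hlim.comp hξm)
  have h2 : Tendsto (fun t => (x (t + 1)).toReal - (x t).toReal) m (𝓝 0) := by
    simpa using! (hreal.comp hadd).sub hreal
  have hbot : m.NeBot := by rcases hm with rfl | rfl <;> infer_instance
  refine tendsto_nhds_unique (h1.congr' ?_) h2
  filter_upwards [hne] with t ht using he t ht

end IsTrajectory

/-! ### Existence of the pullback attractor -/

variable {f f' : ℝ → ℝ → ℝ} {Λ : ℝ → ℝ} {r : ℝ}

namespace IsRegularField

/-- The field truncated to the box `[-N, N]`. -/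
noncomputable def clamped (f : ℝ → ℝ → ℝ) (Λ : ℝ → ℝ) (r N t x : ℝ) : ℝ :=
  f (max (-N) (min N x)) (Λ (r * t))

theorem clamped_eq {N x : ℝ} (hx : x ∈ Icc (-N) N) (t : ℝ) :
    clamped f Λ r N t x = f x (Λ (r * t)) := by
  rw [clamped, min_eq_right hx.2, max_eq_right hx.1]

-- Truncating the state to a box gives the global Lipschitz constant and bound that
-- `exists_global_solution` needs; the original field has neither.
open scoped NNReal in
theorem exists_clamped_constants (hf : IsRegularField f f') (hΛ : IsParameterShift 0 1 Λ)
    {N : ℝ} (hN : 0 ≤ N) : ∃ K B : ℝ≥0, (∀ t, LipschitzWith K (clamped f Λ r N t)) ∧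
      (∀ t x, |clamped f Λ r N t x| ≤ B) ∧ ∀ x, Continuous fun t => clamped f Λ r N t x := by
  obtain ⟨K, hK, hKl⟩ := hf.exists_lipschitz N
  obtain ⟨B, hB, hBb⟩ := hf.exists_bound N
  have hbox : ∀ x : ℝ, max (-N) (min N x) ∈ Icc (-N) N := fun x =>
    ⟨le_max_left _ _, max_le (by linarith) (min_le_left _ _)⟩
  refine ⟨⟨K, hK.le⟩, ⟨B, hB.le⟩, fun t => LipschitzWith.of_dist_le_mul fun x y => ?_,
    fun t x => hBb _ (hΛ.mem_Icc _) _ (hbox x), fun x => ?_⟩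
  · rw [Real.dist_eq, Real.dist_eq]
    refine (hKl _ (hΛ.mem_Icc _) _ (hbox x) _ (hbox y)).trans ?_
    refine mul_le_mul_of_nonneg_left ?_ hK.le
    have h1 := abs_max_sub_max_le_abs (min N x) (min N y) (-N)
    have h2 := abs_min_sub_min_le_max N x N y
    rw [max_comm (-N), max_comm (-N)]
    refine h1.trans (h2.trans ?_)
    simp
  · exact (hf.continuousOn_param _).comp_continuous
      (hΛ.continuous.comp (continuous_const.mul continuous_id)) fun t => hΛ.mem_Icc _

/-- Near the past limit point, the field points into a small strip around it. -/
theorem eventually_strip (hf : IsRegularField f f') {S₀ : ℝ} (hΛ : IsParameterShift 0 1 Λ)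
    (hr : 0 < r) (hS : f S₀ 0 = 0) {ε κ : ℝ} (hκ : 0 < κ)
    (hcon : ∀ᶠ l in 𝓝[Icc 0 1] (0 : ℝ), ∀ x ∈ Icc (S₀ - ε) (S₀ + ε),
      ∀ y ∈ Icc (S₀ - ε) (S₀ + ε), x ≤ y → f y l - f x l ≤ -κ * (y - x)) (hε : 0 < ε) :
    ∀ᶠ t in atBot, 0 < f (S₀ - ε) (Λ (r * t)) ∧ f (S₀ + ε) (Λ (r * t)) < 0 := by
  have h0 : (0 : ℝ) ∈ Icc (0 : ℝ) 1 := ⟨le_rfl, zero_le_one⟩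
  have hc := hcon.self_of_nhdsWithin h0
  have hlim := hΛ.tendsto_mul_atBot hr
  -- At parameter `0`, contraction against the zero `S₀` gives the two signs with margin `κ * ε`,
  -- and continuity carries them to early times.
  have h1 := hc (S₀ - ε) ⟨le_rfl, by linarith⟩ S₀ ⟨by linarith, by linarith⟩ (by linarith)
  have h2 := hc S₀ ⟨by linarith, by linarith⟩ (S₀ + ε) ⟨by linarith, le_rfl⟩ (by linarith)
  have hp : 0 < κ * ε := mul_pos hκ hε
  refine ((hf.tendsto_field h0 tendsto_const_nhds hlim).eventually_const_lt ?_).and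
    ((hf.tendsto_field h0 tendsto_const_nhds hlim).eventually_lt_const ?_)
  · rw [hS] at h1; nlinarith
  · rw [hS] at h2; nlinarith

/-- There is a starting point whose whole past stays in the strip: a solution of a truncated
equation on the whole line which stays close to `S₀` up to time `T`. -/
theorem exists_past_solution (hf : IsRegularField f f') (hΛ : IsParameterShift 0 1 Λ)
    {S₀ ε T N : ℝ} (hε : 0 < ε)
    (hstrip : ∀ t ≤ T, 0 < f (S₀ - ε) (Λ (r * t)) ∧ f (S₀ + ε) (Λ (r * t)) < 0)
    (hN : Icc (S₀ - ε) (S₀ + ε) ⊆ Icc (-N) N) :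
    ∃ z : ℝ → ℝ, (∀ t, HasDerivAt z (clamped f Λ r N t (z t)) t) ∧
      ∀ t ≤ T, z t ∈ Icc (S₀ - ε) (S₀ + ε) := by
  have hm1 : S₀ - ε ∈ Icc (S₀ - ε) (S₀ + ε) := ⟨le_rfl, by linarith⟩
  have hm2 : S₀ + ε ∈ Icc (S₀ - ε) (S₀ + ε) := ⟨by linarith, le_rfl⟩
  have hN0 : 0 ≤ N := by
    have h := (hN hm1); linarith [h.1, h.2]
  obtain ⟨K, B, hK, hB, hcont⟩ := hf.exists_clamped_constants (r := r) hΛ hN0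
  -- Solutions released from `S₀` at time `T - n` are trapped in the strip until `T`. A subsequence
  -- converges at time `T`, and the exponential separation bound spreads the convergence to every
  -- earlier time.
  choose z hz0 hz using fun n : ℕ => exists_global_solution hK hB hcont (T - n) S₀
  have hstay : ∀ n : ℕ, ∀ t ∈ Icc (T - n) T, z n t ∈ Icc (S₀ - ε) (S₀ + ε) := by
    intro n t ht
    have hzc : Continuous fun u => ((z n u : ℝ) : EReal) :=
      continuous_coe_real_ereal.comp
        (continuous_iff_continuousAt.2 fun u => (hz n u).continuousAt)
    constructor
    · refine EReal.coe_le_coe_iff.1 (lower_barrier (x := fun u => ((z n u : ℝ) : EReal)) hzc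
        (c := fun _ => S₀ - ε) (c' := fun _ => 0) (t₁ := T)
        (fun u _ => hasDerivAt_const u _) (fun u hu he => ⟨_, ?_, hz n u⟩) ?_ t ht)
      · rw [EReal.coe_eq_coe_iff.1 he, clamped_eq (hN hm1)]
        exact (hstrip u hu.2).1
      · rw [hz0]; exact EReal.coe_le_coe_iff.2 (by linarith)
    · refine EReal.coe_le_coe_iff.1 (upper_barrier (x := fun u => ((z n u : ℝ) : EReal)) hzc
        (c := fun _ => S₀ + ε) (c' := fun _ => 0) (t₁ := T)
        (fun u _ => hasDerivAt_const u _) (fun u hu he => ⟨_, ?_, hz n u⟩) ?_ t ht)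
      · rw [EReal.coe_eq_coe_iff.1 he, clamped_eq (hN hm2)]
        exact (hstrip u hu.2).2
      · rw [hz0]; exact EReal.coe_le_coe_iff.2 (by linarith)
  obtain ⟨ξ, -, φ, hφ, hlim⟩ := (isCompact_Icc (a := S₀ - ε) (b := S₀ + ε)).tendsto_subseq
    (x := fun n => z n T) fun n => hstay n T ⟨by simp, le_rfl⟩
  obtain ⟨w, hw0, hw⟩ := exists_global_solution hK hB hcont T ξ
  refine ⟨w, hw, fun t ht => ?_⟩
  have hKd : ∀ t x y, |clamped f Λ r N t x - clamped f Λ r N t y| ≤ K * |x - y| := fun t x y => by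
    simpa [Real.dist_eq] using (hK t).dist_le_mul x y
  have hconv : Tendsto (fun n => z (φ n) t) atTop (𝓝 (w t)) := by
    rw [tendsto_iff_dist_tendsto_zero]
    refine squeeze_zero (g := fun n => Real.exp (K * |t - T|) * |z (φ n) T - ξ|)
      (fun _ => dist_nonneg) (fun n => ?_) ?_
    · rw [Real.dist_eq, ← hw0]
      exact abs_sub_le_exp_mul hKd (hz (φ n)) hw T t
    · have h1 : Tendsto (fun n => |z (φ n) T - ξ|) atTop (𝓝 0) := by
        have := (hlim.sub_const ξ).abs
        simpa using! this
      simpa using h1.const_mul (Real.exp (K * |t - T|))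
  refine isClosed_Icc.mem_of_tendsto hconv ?_
  obtain ⟨n₀, hn₀⟩ := exists_nat_ge (T - t)
  filter_upwards [eventually_ge_atTop n₀] with n hn
  refine hstay _ t ⟨?_, ht⟩
  have h1 : (n₀ : ℝ) ≤ φ n := by exact_mod_cast hn.trans (hφ.id_le n)
  linarith

/-- A solution of a truncated equation on the whole line that starts in a strip extends to a
trajectory on `[-∞, ∞)`, by removing the truncation. -/
theorem exists_trajectory_of_past (hf : IsRegularField f f') (hΛ : IsParameterShift 0 1 Λ)
    {M T : ℝ} (hM0 : 0 < M) (hM : ∀ l ∈ Icc (0 : ℝ) 1, ∀ x, M ≤ |x| → f x l < 0) {z : ℝ → ℝ}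
    (hz : ∀ t, HasDerivAt z (clamped f Λ r M t (z t)) t) (hzM : ∀ t ≤ T, z t ∈ Ioo (-M) M) :
    ∃ x, IsTrajectory f Λ r x ∧ ∀ t ≤ T, x t = z t := by
  have hex : ∀ k : ℕ, ∃ w : ℝ → ℝ, w T = z T ∧
      ∀ t, HasDerivAt w (clamped f Λ r (M + k) t (w t)) t := by
    intro k
    obtain ⟨K, B, hK, hB, hcont⟩ := hf.exists_clamped_constants (r := r) hΛ
      (by positivity : 0 ≤ M + k)
    exact exists_global_solution hK hB hcont T (z T)
  choose W hWT hW using hex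
  have hWc : ∀ k, Continuous (W k) := fun k =>
    continuous_iff_continuousAt.2 fun u => (hW k u).continuousAt
  -- before `T` all these solutions agree with `z`
  have hWz : ∀ k, ∀ t ≤ T, W k t = z t := by
    intro k t ht
    obtain ⟨K, B, hK, hB, hcont⟩ := hf.exists_clamped_constants (r := r) hΛ
      (by positivity : 0 ≤ M + k)
    refine ODE_solution_unique_of_mem_Icc_left (v := clamped f Λ r (M + k)) (s := fun _ => univ)
      (K := K) (fun t _ => (hK t).lipschitzOnWith) (hWc k).continuousOn
      (fun t _ => (hW k t).hasDerivWithinAt) (fun _ _ => trivial)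
      (fun u _ => (hz u).continuousAt.continuousWithinAt) (fun u hu => ?_) (fun _ _ => trivial)
      (hWT k) (⟨le_rfl, ht⟩ : t ∈ Icc t T)
    have h1 := hzM u hu.2
    have h2 : z u ∈ Icc (-(M + k)) (M + k) :=
      ⟨by linarith [h1.1, k.cast_nonneg (α := ℝ)], by linarith [h1.2, k.cast_nonneg (α := ℝ)]⟩
    have h3 := hz u
    rw [clamped_eq (Ioo_subset_Icc_self h1), ← clamped_eq (f := f) (Λ := Λ) (r := r) h2] at h3
    exact h3.hasDerivWithinAt
  have hWE : ∀ k, Continuous fun u => ((W k u : ℝ) : EReal) := fun k =>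
    continuous_coe_real_ereal.comp (hWc k)
  have hup : ∀ k t, W k t ≤ M := by
    intro k t
    rcases le_total t T with h | h
    · rw [hWz k t h]; exact (hzM t h).2.le
    · refine EReal.coe_le_coe_iff.1 (upper_barrier (hWE k) (c := fun _ => M) (c' := fun _ => 0)
        (t₁ := t) (fun u _ => hasDerivAt_const u _) (fun u hu he => ⟨_, ?_, hW k u⟩) ?_ t
        ⟨h, le_rfl⟩)
      · rw [EReal.coe_eq_coe_iff.1 he, clamped_eq ⟨by linarith [k.cast_nonneg (α := ℝ)],
          by linarith [k.cast_nonneg (α := ℝ)]⟩]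
        exact hM _ (hΛ.mem_Icc _) _ (le_abs_self M)
      · rw [hWT]; exact EReal.coe_le_coe_iff.2 (hzM T le_rfl).2.le
  have hupk : ∀ k t, W k t ≤ M + k := fun k t => (hup k t).trans (by simp)
  -- the times up to which the truncation at level `k` is not felt
  let A : ℕ → Set ℝ := fun k => {t | ∀ s ≤ t, -(M + k) < W k s}
  have hAdown : ∀ k s t, s ≤ t → t ∈ A k → s ∈ A k := fun k s t hst ht u hu => ht u (hu.trans hst)
  -- A solution of level `j` that stays inside both boxes also solves the equation of level `k`, so
  -- uniqueness applies.
  have hagree : ∀ (j k : ℕ) (t : ℝ), t ∈ A j → (∀ s ≤ t, -(M + k) < W j s) → W k t = W j t := by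
    intro j k t htj htk
    rcases le_total t T with h | h
    · rw [hWz j t h, hWz k t h]
    obtain ⟨K, B, hK, hB, hcont⟩ := hf.exists_clamped_constants (r := r) hΛ
      (by positivity : 0 ≤ M + k)
    refine ODE_solution_unique_of_mem_Icc_right (v := clamped f Λ r (M + k)) (s := fun _ => univ)
      (K := K) (fun t _ => (hK t).lipschitzOnWith) (hWc k).continuousOn
      (fun t _ => (hW k t).hasDerivWithinAt) (fun _ _ => trivial)
      (hWc j).continuousOn (fun u hu => ?_) (fun _ _ => trivial)
      ((hWT k).trans (hWT j).symm) (⟨h, le_rfl⟩ : t ∈ Icc T t)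
    have h3 := hW j u
    rw [clamped_eq ⟨(htj u hu.2.le).le, hupk j u⟩,
      ← clamped_eq (f := f) (Λ := Λ) (r := r) (N := M + k) ⟨(htk u hu.2.le).le, (hup j u).trans (by simp)⟩] at h3
    exact h3.hasDerivWithinAt
  have hAA : ∀ j k t, j ≤ k → t ∈ A j → W k t = W j t := by
    intro j k t hjk ht
    have hjk' : (j : ℝ) ≤ k := by exact_mod_cast hjk
    exact hagree j k t ht fun s hs => by linarith [ht s hs]
  classical
  -- Times that belong to no `A k` are those at or after the escape to `-∞`.
  let x : ℝ → EReal := fun t => if h : ∃ k, t ∈ A k then ((W h.choose t : ℝ) : EReal) else ⊥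
  have hxA : ∀ k t, t ∈ A k → x t = W k t := by
    intro k t ht
    have h : ∃ k, t ∈ A k := ⟨k, ht⟩
    simp only [x, dif_pos h]
    rcases le_total k h.choose with hle | hle
    · rw [hAA _ _ t hle ht]
    · rw [hAA _ _ t hle h.choose_spec]
  have hxbot : ∀ t, x t = ⊥ ↔ ¬ ∃ k, t ∈ A k := by
    intro t
    constructor
    · rintro h ⟨k, hk⟩
      rw [hxA k t hk] at h
      exact EReal.coe_ne_bot _ h
    · intro h
      simp only [x, dif_neg h]
  have hAopen : ∀ k t, t ∈ A k → ∀ᶠ u in 𝓝 t, u ∈ A k := by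
    intro k t ht
    have h1 : ∀ᶠ u in 𝓝 t, -(M + k) < W k u :=
      (hWc k).continuousAt.eventually_const_lt (ht t le_rfl)
    obtain ⟨δ, hδ, hb⟩ := Metric.eventually_nhds_iff_ball.1 h1
    rw [Real.ball_eq_Ioo] at hb
    filter_upwards [Ioo_mem_nhds (by linarith : t - δ < t) (by linarith : t < t + δ)] with u hu
    intro s hs
    rcases le_total s t with h | h
    · exact ht s h
    · exact hb s ⟨by linarith, by linarith [hu.2]⟩
  have hxev : ∀ k t, t ∈ A k → x =ᶠ[𝓝 t] fun u => ((W k u : ℝ) : EReal) := fun k t ht => by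
    filter_upwards [hAopen k t ht] with u hu using hxA k u hu
  -- The field is negative at the level `-(M + k)`, so a solution at or below it after `T` cannot
  -- return above. Being above now means having always been above.
  have hxlow : ∀ (k : ℕ) t, (-(M + k) : ℝ) < x t → t ∈ A k := by
    intro k t ht
    obtain ⟨j, hj⟩ : ∃ j, t ∈ A j := by
      by_contra h
      rw [(hxbot t).2 h] at ht
      exact not_lt_bot ht
    rw [hxA j t hj, EReal.coe_lt_coe_iff] at ht
    have hall : ∀ s ≤ t, -(M + k) < W j s := by
      intro s hs
      rcases le_total s T with h | h
      · rw [hWz j s h]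
        linarith [(hzM s h).1, k.cast_nonneg (α := ℝ)]
      · by_contra! hle
        have : W j t ≤ -(M + k) := by
          refine EReal.coe_le_coe_iff.1 (upper_barrier (hWE j) (c := fun _ => -(M + k))
            (c' := fun _ => 0) (t₁ := t) (fun u _ => hasDerivAt_const u _)
            (fun u hu he => ⟨_, ?_, hW j u⟩) (EReal.coe_le_coe_iff.2 hle) t ⟨hs, le_rfl⟩)
          rw [clamped_eq ⟨(hj u hu.2).le, hupk j u⟩, EReal.coe_eq_coe_iff.1 he]
          refine hM _ (hΛ.mem_Icc _) _ ?_
          rw [abs_neg]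
          exact (by linarith [k.cast_nonneg (α := ℝ)] : M ≤ M + k).trans (le_abs_self _)
        linarith
    intro s hs
    have hsj := hAdown j s t hs hj
    rw [hagree j k s hsj fun u hu => hall u (hu.trans hs)]
    exact hall s hs
  refine ⟨x, ⟨fun t => ?_, ?_, fun t ht => ?_, fun s t hst hs => ?_⟩, fun t ht => ?_⟩
  · by_cases h : ∃ k, t ∈ A k
    · obtain ⟨k, hk⟩ := h
      rw [hxA k t hk]; exact EReal.coe_ne_top _
    · rw [(hxbot t).2 h]; exact bot_ne_top
  · rw [continuous_iff_continuousAt]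
    intro t
    by_cases h : ∃ k, t ∈ A k
    · obtain ⟨k, hk⟩ := h
      exact (hWE k).continuousAt.congr (hxev k t hk).symm
    · rw [ContinuousAt, (hxbot t).2 h, EReal.tendsto_nhds_bot_iff_real]
      intro y
      obtain ⟨k, hk⟩ := exists_nat_gt (-y - M)
      have hky : -(M + k) < y := by linarith
      -- If `x` stayed above `-(M + k)` before `t`, the solution of level `k + 1` would still be
      -- inside its larger box at `t`, so `x t` would be finite. Hence `x` drops to this level
      -- before `t`, and it cannot climb back.
      obtain ⟨u₀, hu₀, hxu₀⟩ : ∃ u₀ < t, x u₀ ≤ (-(M + k) : ℝ) := by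
        by_contra! hall
        refine h ⟨k + 1, ?_⟩
        have hA : ∀ u < t, u ∈ A k := fun u hu => hxlow k u (hall u hu)
        have hlt : ∀ u < t, -(M + k) < W (k + 1) u := fun u hu => by
          rw [hAA k (k + 1) u (Nat.le_succ k) (hA u hu)]
          exact hA u hu u le_rfl
        have hle : -(M + k) ≤ W (k + 1) t := by
          refine ge_of_tendsto ((hWc (k + 1)).continuousAt.tendsto.mono_left
            (nhdsWithin_le_nhds (s := Iio t))) ?_
          filter_upwards [self_mem_nhdsWithin] with u hu using (hlt u hu).le
        intro s hs
        push_cast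
        rcases hs.lt_or_eq with hs | rfl
        · linarith [hlt s hs]
        · linarith
      filter_upwards [lt_mem_nhds hu₀] with u hu
      by_contra! hyu
      have huA : u ∈ A k := hxlow k u ((EReal.coe_lt_coe_iff.2 hky).trans_le hyu)
      have hu₀A := hAdown k u₀ u hu.le huA
      rw [hxA k u₀ hu₀A, EReal.coe_le_coe_iff] at hxu₀
      exact absurd (hu₀A u₀ le_rfl) (not_lt.2 hxu₀)
  · obtain ⟨k, hk⟩ : ∃ k, t ∈ A k := by
      by_contra h
      exact ht ((hxbot t).2 h)
    have h1 := hW k t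
    rw [clamped_eq ⟨(hk t le_rfl).le, hupk k t⟩] at h1
    rw [hxA k t hk, EReal.toReal_coe]
    refine h1.congr_of_eventuallyEq ?_
    filter_upwards [hxev k t hk] with u hu
    rw [hu, EReal.toReal_coe]
  · rw [hxbot] at hs ⊢
    rintro ⟨k, hk⟩
    exact hs ⟨k, hAdown k s t hst hk⟩
  · have : t ∈ A 0 := by
      intro s hs
      rw [hWz 0 s (hs.trans ht)]
      simpa using (hzM s (hs.trans ht)).1
    rw [hxA 0 t this, hWz 0 t ht]

/-- Existence of the pullback attractor of a linearly stable equilibrium. -/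
theorem exists_pullback (hf : IsRegularField f f') (hΛ : IsParameterShift 0 1 Λ) (hr : 0 < r)
    {S₀ : ℝ} (hS : f S₀ 0 = 0) (hneg : f' S₀ 0 < 0) :
    ∃ x, IsPullbackTrajectory f Λ r S₀ x := by
  have h0 : (0 : ℝ) ∈ Icc (0 : ℝ) 1 := ⟨le_rfl, zero_le_one⟩
  obtain ⟨ε, hε, κ, hκ, hcon⟩ := hf.exists_contraction h0 hneg
  obtain ⟨T, hT⟩ := eventually_atBot.1 (hf.eventually_strip hΛ hr hS hκ hcon hε)
  obtain ⟨M, hM0, hM⟩ := hf.neg_of_large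
  -- The box must contain the strip in its interior and still have the field negative outside.
  set N := max M (|S₀| + ε + 1) with hN
  have hMN : M ≤ N := le_max_left _ _
  have hNS : |S₀| + ε + 1 ≤ N := le_max_right _ _
  have hsub : Icc (S₀ - ε) (S₀ + ε) ⊆ Ioo (-N) N := fun y hy =>
    ⟨by linarith [hy.1, neg_abs_le S₀], by linarith [hy.2, le_abs_self S₀]⟩
  obtain ⟨z, hz, hzs⟩ := hf.exists_past_solution hΛ hε hT (hsub.trans Ioo_subset_Icc_self)
  obtain ⟨x, hx, hxz⟩ := hf.exists_trajectory_of_past hΛ (hM0.trans_le hMN)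
    (fun l hl y hy => hM l hl y (hMN.trans hy)) hz (fun t ht => hsub (hzs t ht))
  refine ⟨x, hx, ?_⟩
  have hlim := hΛ.tendsto_mul_atBot hr
  obtain ⟨L, hL⟩ := hx.exists_tendsto hf (Or.inr rfl) h0 hlim
  have hlow : ((S₀ - ε : ℝ) : EReal) ≤ L := ge_of_tendsto hL (by
    filter_upwards [eventually_le_atBot T] with t ht
    rw [hxz t ht]; exact EReal.coe_le_coe_iff.2 (hzs t ht).1)
  have hupp : L ≤ ((S₀ + ε : ℝ) : EReal) := le_of_tendsto hL (by
    filter_upwards [eventually_le_atBot T] with t ht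
    rw [hxz t ht]; exact EReal.coe_le_coe_iff.2 (hzs t ht).2)
  lift L to ℝ using ⟨fun h => by rw [h] at hupp; exact absurd hupp (not_le.2 (EReal.coe_lt_top _)),
    fun h => by rw [h] at hlow; exact absurd hlow (not_le.2 (EReal.bot_lt_coe _))⟩
  rw [EReal.coe_le_coe_iff] at hlow hupp
  have hfL := hx.limit_eq_zero hf (Or.inr rfl) h0 hlim hL
  have hc := hcon.self_of_nhdsWithin h0
  -- The limit is an equilibrium in the strip, and contraction allows only one there.
  have hLS : L = S₀ := by
    rcases le_total L S₀ with h | h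
    · have := hc L ⟨hlow, hupp⟩ S₀ ⟨by linarith, by linarith⟩ h
      rw [hS, hfL] at this
      nlinarith
    · have := hc S₀ ⟨by linarith, by linarith⟩ L ⟨hlow, hupp⟩ h
      rw [hS, hfL] at this
      nlinarith
  rwa [hLS] at hL

end IsRegularField

/-! ### Dependence on the rate, and uniqueness -/

variable {f f' : ℝ → ℝ → ℝ} {Λ : ℝ → ℝ}

namespace IsRegularField

/-- Lower semicontinuity of the pullback attractor in the rate, as long as it stays finite. -/
theorem eventually_sub_le_pullback (hf : IsRegularField f f') (hΛ : IsParameterShift 0 1 Λ)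
    {r₀ S₀ : ℝ} (hr₀ : 0 < r₀) (hneg : f' S₀ 0 < 0) {y : ℝ → EReal}
    (hy : IsPullbackTrajectory f Λ r₀ S₀ y) {T : ℝ} (hT : y T ≠ ⊥) {η : ℝ} (hη : 0 < η) :
    ∀ᶠ r in 𝓝 r₀, ∀ x, IsPullbackTrajectory f Λ r S₀ x →
      (((y T).toReal - η : ℝ) : EReal) ≤ x (r₀ / r * T) := by
  obtain ⟨hyt, hylim⟩ := hy
  have h0 : (0 : ℝ) ∈ Icc (0 : ℝ) 1 := ⟨le_rfl, zero_le_one⟩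
  obtain ⟨ε, hε, κ, hκ, hcon⟩ := hf.exists_contraction h0 hneg
  have hfin : ∀ t ≤ T, y t ≠ ⊥ := fun t ht h => hT (hyt.absorbing t T ht h)
  set Y : ℝ → ℝ := fun t => (y t).toReal with hY
  have hYder : ∀ t ≤ T, HasDerivAt Y (f (Y t) (Λ (r₀ * t))) t := fun t ht =>
    hyt.hasDerivAt t (hfin t ht)
  have hYlim : Tendsto Y atBot (𝓝 S₀) := by
    simpa using! (EReal.tendsto_toReal (EReal.coe_ne_top S₀) (EReal.coe_ne_bot S₀)).comp hylim
  have hYev : ∀ᶠ t in atBot, Y t ∈ Icc (S₀ - ε / 2) (S₀ + ε / 2) :=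
    hYlim.eventually (Icc_mem_nhds (by linarith) (by linarith))
  obtain ⟨T₁, hT₁⟩ := eventually_atBot.1
    ((hYev.and ((hΛ.tendsto_mul_atBot hr₀).eventually hcon)).and (eventually_le_atBot T))
  have hT₁T : T₁ ≤ T := (hT₁ T₁ le_rfl).2
  obtain ⟨N, hN⟩ : ∃ N, ∀ t ≤ T, |Y t| ≤ N := by
    obtain ⟨C, hC⟩ := (isCompact_Icc (a := T₁) (b := T)).exists_bound_of_continuousOn
      (f := Y) fun t ht => (hYder t ht.2).continuousAt.continuousWithinAt
    refine ⟨max C (|S₀| + ε), fun t ht => ?_⟩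
    rcases le_total t T₁ with h | h
    · refine le_max_of_le_right (abs_le.2 ?_)
      have := (hT₁ t h).1.1
      constructor <;> linarith [this.1, this.2, neg_abs_le S₀, le_abs_self S₀]
    · exact le_max_of_le_left (hC t ⟨h, ht⟩)
  obtain ⟨B, hB, hBb⟩ := hf.exists_bound (N + 1)
  obtain ⟨K, hK, hKl⟩ := hf.exists_lipschitz (N + 1)
  -- `E` bounds the growth of the error between `T₁` and `T` at rate `K + 1`. The factor `2` allows
  -- for the rescaled interval, since only ratios `ρ > 1/2` are used. Then `θ` is an initial error
  -- that stays below `ε / 2`, `1` and `η` even after this growth.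
  set E := Real.exp ((K + 1) * (2 * (T - T₁))) with hE
  have hE1 : 1 ≤ E := Real.one_le_exp (by have : 0 ≤ T - T₁ := by linarith
                                          positivity)
  set θ := min (ε / 2) (min 1 η) / E with hθ
  have hmin : 0 < min (ε / 2) (min 1 η) := by positivity
  have hθ0 : 0 < θ := by positivity
  have hθE : θ * E = min (ε / 2) (min 1 η) := by rw [hθ]; field_simp
  have hθle : θ ≤ ε / 2 := by
    calc θ ≤ θ * E := le_mul_of_one_le_right hθ0.le hE1
      _ ≤ ε / 2 := hθE ▸ min_le_left _ _
  have hθ1 : θ * E ≤ 1 := hθE ▸ (min_le_right _ _).trans (min_le_left _ _)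
  have hθη : θ * E ≤ η := hθE ▸ (min_le_right _ _).trans (min_le_right _ _)
  have hρlim : Tendsto (fun r => r / r₀) (𝓝 r₀) (𝓝 1) := by
    have : Tendsto (fun r => r / r₀) (𝓝 r₀) (𝓝 (r₀ / r₀)) := tendsto_id.div_const r₀
    rwa [div_self hr₀.ne'] at this
  have hsmall : Tendsto (fun r => |r / r₀ - 1| * B) (𝓝 r₀) (𝓝 0) := by
    simpa using ((hρlim.sub_const 1).abs.mul_const B)
  filter_upwards [hρlim.eventually_const_lt (by norm_num : (1 / 2 : ℝ) < 1),
    hsmall.eventually_lt_const (mul_pos hκ hθ0), hsmall.eventually_lt_const hθ0]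
    with r hρ hs1 hs2 x hx
  obtain ⟨hxt, hxlim⟩ := hx
  -- In the rescaled time `ρ * t` the reference trajectory sees the same parameter `Λ (r * t)` as
  -- `x`. The price is a factor `ρ` in its equation, an error of at most `|ρ - 1| * B`.
  set ρ := r / r₀ with hρdef
  have hρ0 : 0 < ρ := by linarith
  have hr : 0 < r := by
    have : r = ρ * r₀ := by rw [hρdef]; field_simp
    rw [this]; positivity
  have hΛρ : ∀ t, Λ (r₀ * (ρ * t)) = Λ (r * t) := fun t => by
    congr 1; rw [hρdef]; field_simp
  have hpert : ∀ t, ρ * t ≤ T → ρ * f (Y (ρ * t)) (Λ (r * t)) ≤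
      f (Y (ρ * t)) (Λ (r * t)) + |ρ - 1| * B := by
    intro t ht
    have h1 := hBb _ (hΛ.mem_Icc (r * t)) (Y (ρ * t))
      (by have := abs_le.1 (hN _ ht); constructor <;> linarith [this.1, this.2])
    have h2 : (ρ - 1) * f (Y (ρ * t)) (Λ (r * t)) ≤ |ρ - 1| * B :=
      (le_abs_self _).trans (by rw [abs_mul]; gcongr)
    linarith
  have hYρ : ∀ t, ρ * t ≤ T →
      HasDerivAt (fun u => Y (ρ * u)) (ρ * f (Y (ρ * t)) (Λ (r * t))) t := by
    intro t ht
    have := (hYder _ ht).comp t ((hasDerivAt_id t).const_mul ρ)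
    rw [hΛρ] at this
    convert! this using 1
    simp; ring
  have hle1 : ∀ t, t ≤ T₁ / ρ → ρ * t ≤ T₁ := fun t ht => by
    rw [mul_comm]; exact (le_div_iff₀ hρ0).1 ht
  have hle2 : ∀ t, t ≤ T / ρ → ρ * t ≤ T := fun t ht => by
    rw [mul_comm]; exact (le_div_iff₀ hρ0).1 ht
  -- the past
  have hpast : ((Y (ρ * (T₁ / ρ)) - θ : ℝ) : EReal) ≤ x (T₁ / ρ) := by
    have hclim : Tendsto (fun t => ((Y (ρ * t) - θ : ℝ) : EReal)) atBot
        (𝓝 ((S₀ - θ : ℝ) : EReal)) :=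
      EReal.tendsto_coe.2 ((hYlim.comp (tendsto_id.const_mul_atBot hρ0)).sub_const θ)
    have hev := hclim.eventually_lt hxlim (EReal.coe_lt_coe_iff.2 (by linarith))
    obtain ⟨t₀, ht₀, ht₀'⟩ := (hev.and (eventually_le_atBot (T₁ / ρ))).exists
    refine hxt.le_of_lower_barrier (c := fun t => Y (ρ * t) - θ)
      (fun t ht => (hYρ t ((hle1 t ht.2).trans hT₁T)).sub_const θ) (fun t ht => ?_) ht₀.le
      (T₁ / ρ) ⟨ht₀', le_rfl⟩
    have hρt := hle1 t ht.2
    obtain ⟨⟨hYI, hc⟩, -⟩ := hT₁ _ hρt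
    rw [hΛρ] at hc
    have h1 := hc (Y (ρ * t) - θ) ⟨by linarith [hYI.1], by linarith [hYI.2]⟩ (Y (ρ * t))
      -- Lowering the state by `θ` raises the field by at least `κ * θ`, which beats the rescaling
      -- error.
      ⟨by linarith [hYI.1], by linarith [hYI.2]⟩ (by linarith)
    have h2 := hpert t (hρt.trans hT₁T)
    have h3 : Y (ρ * t) - (Y (ρ * t) - θ) = θ := by ring
    rw [h3] at h1
    linarith
  -- the bounded time interval
  set w : ℝ → ℝ := fun t => θ * Real.exp ((K + 1) * (t - T₁ / ρ)) with hw
  have hwder : ∀ t, HasDerivAt w ((K + 1) * w t) t := by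
    intro t
    have := ((((hasDerivAt_id t).sub_const (T₁ / ρ)).const_mul (K + 1)).exp).const_mul θ
    convert! this using 1
    simp [hw]; ring
  have hwle : ∀ t ≤ T / ρ, w t ≤ θ * E := by
    intro t ht
    refine mul_le_mul_of_nonneg_left (Real.exp_le_exp.2 ?_) hθ0.le
    refine mul_le_mul_of_nonneg_left ?_ (by linarith)
    have : T / ρ - T₁ / ρ ≤ 2 * (T - T₁) := by
      rw [← sub_div, div_le_iff₀ hρ0]
      nlinarith
    linarith
  have hwge : ∀ t, T₁ / ρ ≤ t → θ ≤ w t := fun t ht =>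
    le_mul_of_one_le_right hθ0.le (Real.one_le_exp (mul_nonneg (by linarith) (by linarith)))
  have hmain := hxt.le_of_lower_barrier (c := fun t => Y (ρ * t) - w t) (t₀ := T₁ / ρ)
    (t₁ := T / ρ)
    (fun t ht => (hYρ t (hle2 t ht.2)).sub (hwder t)) (fun t ht => ?_)
    (by simpa [hw] using hpast) (T / ρ) ⟨by gcongr, le_rfl⟩
  · have he : r₀ / r * T = T / ρ := by rw [hρdef]; field_simp
    rw [he]
    refine le_trans (EReal.coe_le_coe_iff.2 ?_) hmain
    have h1 : ρ * (T / ρ) = T := by field_simp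
    rw [h1]
    linarith [hwle (T / ρ) le_rfl]
  -- The margin `w` grows at rate `K + 1`: the part `K * w` absorbs the Lipschitz change of the
  -- field, and the remaining `w ≥ θ` absorbs the rescaling error.
  · have hρt := hle2 t ht.2
    have hYb := abs_le.1 (hN _ hρt)
    have hw1 : w t ≤ 1 := (hwle t ht.2).trans hθ1
    have hwθ := hwge t ht.1
    have h1 := hKl _ (hΛ.mem_Icc (r * t)) (Y (ρ * t))
      ⟨by linarith [hYb.1], by linarith [hYb.2]⟩ (Y (ρ * t) - w t)
      ⟨by linarith [hYb.1], by linarith [hYb.2]⟩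
    have h3 : Y (ρ * t) - (Y (ρ * t) - w t) = w t := by ring
    rw [h3, abs_of_pos (hθ0.trans_le hwθ)] at h1
    have h2 := hpert t hρt
    have h4 := le_abs_self (f (Y (ρ * t)) (Λ (r * t)) - f (Y (ρ * t) - w t) (Λ (r * t)))
    nlinarith

/-- Uniqueness of the pullback attractor of a linearly stable equilibrium. -/
theorem pullback_unique (hf : IsRegularField f f') (hΛ : IsParameterShift 0 1 Λ)
    {r S₀ : ℝ} (hr : 0 < r) (hneg : f' S₀ 0 < 0) {x y : ℝ → EReal}
    (hx : IsPullbackTrajectory f Λ r S₀ x) (hy : IsPullbackTrajectory f Λ r S₀ y) : x = y := by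
  have key : ∀ {x y : ℝ → EReal}, IsPullbackTrajectory f Λ r S₀ x →
      IsPullbackTrajectory f Λ r S₀ y → ∀ t, y t ≤ x t := by
    intro x y hx hy t
    by_cases h : y t = ⊥
    · rw [h]; exact bot_le
    rw [← EReal.coe_toReal (hy.1.ne_top t) h]
    refine EReal.ge_of_forall_gt_iff_ge.1 fun z hz => ?_
    have hz' := EReal.coe_lt_coe_iff.1 hz
    -- Uniqueness is the rate comparison at `r = r₀`, used with every margin and in both directions.
    have := (hf.eventually_sub_le_pullback hΛ hr hneg hy h (sub_pos.2 hz')).self_of_nhds x hx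
    rw [div_self hr.ne', one_mul] at this
    simpa using! this
  exact funext fun t => le_antisymm (key hy hx t) (key hx hy t)

end IsRegularField

/-! ### Bistable fields: tracking, and no tipping in (a) and (b) -/

variable {f f' : ℝ → ℝ → ℝ} {Λ : ℝ → ℝ}

/-- The derivative vanishes at both ends and is continuous on the compact rest. This bounds the
speed of the moving equilibrium by a multiple of the rate. -/
theorem IsParameterShift.exists_deriv_bound (hΛ : IsParameterShift 0 1 Λ) :
    ∃ C > 0, ∀ s, |deriv Λ s| ≤ C := by
  have hc : Continuous (deriv Λ) := hΛ.contDiff.continuous_deriv (by norm_num)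
  obtain ⟨a, ha⟩ := eventually_atBot.1 (hΛ.deriv_atBot.abs.eventually_le_const
    (by simp : |(0 : ℝ)| < 1))
  obtain ⟨b, hb⟩ := eventually_atTop.1 (hΛ.deriv_atTop.abs.eventually_le_const
    (by simp : |(0 : ℝ)| < 1))
  obtain ⟨C, hC⟩ := (isCompact_Icc (a := a) (b := b)).exists_bound_of_continuousOn hc.continuousOn
  refine ⟨max C 1, by positivity, fun s => ?_⟩
  rcases le_total s a with h | h
  · exact (ha s h).trans (le_max_right _ _)
  rcases le_total b s with h' | h'
  · exact (hb s h').trans (le_max_right _ _)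
  · exact (hC s ⟨h, h'⟩).trans (le_max_left _ _)

theorem IsRegularField.continuousOn_comp (hf : IsRegularField f f') {g : ℝ → ℝ}
    (hg : ContinuousOn g (Icc 0 1)) : ContinuousOn (fun l => f (g l) l) (Icc 0 1) :=
  hf.continuousOn.comp (f := fun l : ℝ => (g l, l)) (hg.prodMk continuousOn_id)
    fun _ hl => ⟨trivial, hl⟩

theorem IsRegularField.mem_stableEquilibria (hf : IsRegularField f f') {l y : ℝ}
    (hl : l ∈ Icc (0 : ℝ) 1) (h0 : f y l = 0) (hneg : f' y l < 0) :
    ((y : EReal), l) ∈ stableEquilibria f 0 1 :=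
  ⟨hl, Or.inl ⟨y, rfl, h0, by rw [(hf.hasDerivAt l hl y).deriv]; exact hneg⟩⟩

/-- The future limit of the pullback attractor is unique. -/
theorem PullbackLimit.unique (hf : IsRegularField f f') (hΛ : IsParameterShift 0 1 Λ)
    {r S₀ : ℝ} (hr : 0 < r) (hneg : f' S₀ 0 < 0) {Y Z : EReal}
    (hY : PullbackLimit f Λ r S₀ Y) (hZ : PullbackLimit f Λ r S₀ Z) : Y = Z := by
  obtain ⟨x, hx, hxl⟩ := hY
  obtain ⟨y, hy, hyl⟩ := hZ
  rw [hf.pullback_unique hΛ hr hneg hx hy] at hxl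
  exact tendsto_nhds_unique hxl hyl

/-- A pullback trajectory stays below every level above which the field is negative. -/
theorem IsPullbackTrajectory.le_of_neg (hΛ : IsParameterShift 0 1 Λ) {r S₀ M : ℝ}
    (hM : ∀ l ∈ Icc (0 : ℝ) 1, f M l < 0) (hSM : S₀ < M) {x : ℝ → EReal}
    (hx : IsPullbackTrajectory f Λ r S₀ x) (t : ℝ) : x t ≤ M := by
  obtain ⟨s, hs, hst⟩ := ((hx.2.eventually_lt_const (EReal.coe_lt_coe_iff.2 hSM)).and
    (eventually_le_atBot t)).exists
  exact hx.1.le_const hst (fun u _ => hM _ (hΛ.mem_Icc _)) hs.le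

/-- Two branches of equilibria `U < S` over the whole parameter interval, where `S` is stable from
both sides and attracts everything above `U`, and where the states between the level `p` and `U`
move down. -/
structure IsBistable (f f' : ℝ → ℝ → ℝ) (S U : ℝ → ℝ) (p : ℝ) : Prop
    extends IsRegularField f f' where
  contDiffOn : ContDiffOn ℝ 2 S (Icc 0 1)
  continuousOn_U : ContinuousOn U (Icc 0 1)
  floor_lt : ∀ l ∈ Icc (0 : ℝ) 1, p < U l
  U_lt_S : ∀ l ∈ Icc (0 : ℝ) 1, U l < S l
  zero : ∀ l ∈ Icc (0 : ℝ) 1, f (S l) l = 0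
  deriv_neg : ∀ l ∈ Icc (0 : ℝ) 1, f' (S l) l < 0
  neg_above : ∀ l ∈ Icc (0 : ℝ) 1, ∀ x, S l < x → f x l < 0
  pos_between : ∀ l ∈ Icc (0 : ℝ) 1, ∀ x, U l < x → x < S l → 0 < f x l
  neg_below : ∀ l ∈ Icc (0 : ℝ) 1, ∀ x, p ≤ x → x < U l → f x l < 0

namespace IsBistable

variable {S U : ℝ → ℝ} {p : ℝ}

theorem zero_mem : (0 : ℝ) ∈ Icc (0 : ℝ) 1 := ⟨le_rfl, zero_le_one⟩

theorem one_mem : (1 : ℝ) ∈ Icc (0 : ℝ) 1 := ⟨zero_le_one, le_rfl⟩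

theorem stable (h : IsBistable f f' S U p) {l : ℝ} (hl : l ∈ Icc (0 : ℝ) 1) :
    ((S l : EReal), l) ∈ stableEquilibria f 0 1 :=
  h.toIsRegularField.mem_stableEquilibria hl (h.zero l hl) (h.deriv_neg l hl)

theorem isStableBranch (h : IsBistable f f' S U p) : IsStableBranch f 0 1 S where
  contDiffOn := h.contDiffOn
  mem_equilibria l hl := ⟨hl, Or.inl ⟨S l, rfl, h.zero l hl⟩⟩
  notMem_bifurcation := by
    rintro l hl ⟨hl', y, hy, -, hd⟩
    rw [← EReal.coe_eq_coe_iff.1 hy] at hd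
    simp only at hd
    rw [(h.hasDerivAt l hl' _).deriv] at hd
    exact (h.deriv_neg l hl').ne hd
  mem_closure l hl := subset_closure (h.stable hl)

theorem lambdaConnected (h : IsBistable f f' S U p) (hΛ : IsParameterShift 0 1 Λ) :
    LambdaConnected f 0 1 Λ (S 0) (S 1) := by
  have hS := h.contDiffOn.continuousOn
  have h1 : ∀ s, (1 : ℝ) * s = s := one_mul
  have hlim0 := hΛ.tendsto_mul_atBot one_pos
  have hlim1 := hΛ.tendsto_mul_atTop one_pos
  simp only [h1] at hlim0 hlim1
  refine ⟨h.stable zero_mem, h.stable one_mem, fun s => S (Λ s), ?_, ?_, ?_, fun s => ?_,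
    fun s => subset_closure (h.stable (hΛ.mem_Icc s))⟩
  · exact continuous_coe_real_ereal.comp (hS.comp_continuous hΛ.continuous hΛ.mem_Icc)
  · exact EReal.tendsto_coe.2 ((hS 0 zero_mem).tendsto.comp hlim0)
  · exact EReal.tendsto_coe.2 ((hS 1 one_mem).tendsto.comp hlim1)
  · exact ⟨hΛ.mem_Icc s, Or.inl ⟨S (Λ s), rfl, h.zero _ (hΛ.mem_Icc s)⟩⟩

/-- Supplies a height that no pullback attractor exceeds, above a prescribed level from which a
descent is to be measured. -/
theorem exists_ceiling (h : IsBistable f f' S U p) (q : ℝ) :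
    ∃ M, q < M ∧ S 0 < M ∧ ∀ l ∈ Icc (0 : ℝ) 1, f M l < 0 := by
  obtain ⟨M, hM0, hM⟩ := h.neg_of_large
  refine ⟨M + |q| + |S 0|, ?_, ?_, fun l hl => hM l hl _ ?_⟩
  · linarith [le_abs_self q, abs_nonneg (S 0)]
  · linarith [le_abs_self (S 0), abs_nonneg q]
  · exact le_trans (by linarith [abs_nonneg q, abs_nonneg (S 0)]) (le_abs_self _)

/-- A pullback trajectory which finally stays above the final unstable state tends to the final
stable one. -/
theorem tendsto_of_eventually_ge (h : IsBistable f f' S U p) (hΛ : IsParameterShift 0 1 Λ)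
    {r : ℝ} (hr : 0 < r) {x : ℝ → EReal} (hx : IsPullbackTrajectory f Λ r (S 0) x) {q : ℝ}
    (hq : U 1 < q) (hev : ∀ᶠ t in atTop, (q : EReal) ≤ x t) :
    Tendsto x atTop (𝓝 (S 1 : EReal)) := by
  obtain ⟨L, hL⟩ := hx.1.exists_tendsto h.toIsRegularField (Or.inl rfl) one_mem
    (hΛ.tendsto_mul_atTop hr)
  obtain ⟨M, -, hSM, hM⟩ := h.exists_ceiling 0
  have hlow : (q : EReal) ≤ L := ge_of_tendsto hL hev
  have hupp : L ≤ (M : EReal) := le_of_tendsto hL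
    (Eventually.of_forall fun t => hx.le_of_neg hΛ hM hSM t)
  lift L to ℝ using ⟨fun h => by rw [h] at hupp; exact absurd hupp (not_le.2 (EReal.coe_lt_top _)),
    fun h => by rw [h] at hlow; exact absurd hlow (not_le.2 (EReal.bot_lt_coe _))⟩
  rw [EReal.coe_le_coe_iff] at hlow
  have hfL := hx.1.limit_eq_zero h.toIsRegularField (Or.inl rfl) one_mem
    (hΛ.tendsto_mul_atTop hr) hL
  have hLS : L = S 1 := by
    rcases lt_trichotomy L (S 1) with hlt | heq | hgt
    · exact absurd hfL (h.pos_between 1 one_mem L (hq.trans_le hlow) hlt).ne'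
    · exact heq
    · exact absurd hfL (h.neg_above 1 one_mem L hgt).ne
  rwa [hLS] at hL

theorem exists_pullback (h : IsBistable f f' S U p) (hΛ : IsParameterShift 0 1 Λ)
    {r : ℝ} (hr : 0 < r) : ∃ x, IsPullbackTrajectory f Λ r (S 0) x :=
  h.toIsRegularField.exists_pullback hΛ hr (h.zero 0 zero_mem) (h.deriv_neg 0 zero_mem)

/-- For small rates the pullback attractor tracks the stable branch. -/
theorem tracking (h : IsBistable f f' S U p) (hΛ : IsParameterShift 0 1 Λ) :
    ∃ r₀ > 0, ∀ r, 0 < r → r < r₀ → PullbackLimit f Λ r (S 0) (S 1) := by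
  have hS := h.contDiffOn.continuousOn
  -- The barrier is the curve `S - e / 2`, with `e` a lower bound for the gap between the branches.
  -- The field on it is at least `η`, while its slope along the shift is at most `D * C * r`, which
  -- is below `η` for the rates considered.
  obtain ⟨e, he, hle⟩ := isCompact_Icc.exists_forall_le' (f := fun l => S l - U l)
    (hS.sub h.continuousOn_U) (a := 0) fun l hl => sub_pos.2 (h.U_lt_S l hl)
  obtain ⟨η, hη, hηle⟩ := isCompact_Icc.exists_forall_le' (f := fun l => f (S l - e / 2) l)
    (h.toIsRegularField.continuousOn_comp (hS.sub continuousOn_const)) (a := 0) fun l hl =>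
      h.pos_between l hl _ (by linarith [hle l hl]) (by linarith)
  have hS' : ContinuousOn (derivWithin S (Icc 0 1)) (Icc 0 1) :=
    h.contDiffOn.continuousOn_derivWithin (uniqueDiffOn_Icc zero_lt_one) (by norm_num)
  obtain ⟨D, hD⟩ := isCompact_Icc.exists_bound_of_continuousOn hS'
  have hD0 : 0 ≤ D := (norm_nonneg _).trans (hD 0 zero_mem)
  obtain ⟨C, hC, hCb⟩ := hΛ.exists_deriv_bound
  refine ⟨η / (D * C + 1), by positivity, fun r hr hrlt => ?_⟩
  rw [lt_div_iff₀ (by positivity)] at hrlt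
  obtain ⟨x, hx⟩ := h.exists_pullback hΛ hr
  refine ⟨x, hx, ?_⟩
  have hder : ∀ t, HasDerivAt (fun u => S (Λ (r * u)) - e / 2)
      (derivWithin S (Icc 0 1) (Λ (r * t)) * (deriv Λ (r * t) * r)) t := by
    intro t
    have hm := hΛ.mem_Ioo (r * t)
    have h1 : HasDerivAt S (derivWithin S (Icc 0 1) (Λ (r * t))) (Λ (r * t)) :=
      ((h.contDiffOn.differentiableOn (by norm_num)) _
        (Ioo_subset_Icc_self hm)).hasDerivWithinAt.hasDerivAt (Icc_mem_nhds hm.1 hm.2)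
    have h2 : HasDerivAt Λ (deriv Λ (r * t)) (r * t) :=
      (hΛ.contDiff.differentiable (by norm_num) _).hasDerivAt
    have h3 : HasDerivAt (fun u => r * u) r t := by
      simpa using (hasDerivAt_id t).const_mul r
    exact (h1.comp t (h2.comp t h3)).sub_const _
  have hlt : ∀ t, derivWithin S (Icc 0 1) (Λ (r * t)) * (deriv Λ (r * t) * r) <
      f (S (Λ (r * t)) - e / 2) (Λ (r * t)) := by
    intro t
    refine lt_of_lt_of_le ?_ (hηle _ (hΛ.mem_Icc _))
    refine (le_abs_self _).trans_lt ?_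
    rw [abs_mul, abs_mul, abs_of_pos hr]
    calc |derivWithin S (Icc 0 1) (Λ (r * t))| * (|deriv Λ (r * t)| * r) ≤ D * (C * r) := by
          gcongr
          · exact hD _ (hΛ.mem_Icc _)
          · exact hCb _
      _ < η := by nlinarith
  have hlimS : Tendsto (fun t => S (Λ (r * t))) atBot (𝓝 (S 0)) :=
    (hS 0 zero_mem).tendsto.comp (hΛ.tendsto_mul_atBot hr)
  have hlimS1 : Tendsto (fun t => S (Λ (r * t))) atTop (𝓝 (S 1)) :=
    (hS 1 one_mem).tendsto.comp (hΛ.tendsto_mul_atTop hr)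
  have hbarrier : ∀ t, ((S (Λ (r * t)) - e / 2 : ℝ) : EReal) ≤ x t := by
    intro t
    have hev := (EReal.tendsto_coe.2 (hlimS.sub_const (e / 2))).eventually_lt hx.2
      (EReal.coe_lt_coe_iff.2 (by linarith))
    obtain ⟨t₀, ht₀, htt⟩ := (hev.and (eventually_le_atBot t)).exists
    exact hx.1.le_of_lower_barrier (fun u _ => hder u) (fun u _ => hlt u) ht₀.le t ⟨htt, le_rfl⟩
  -- The level `S 1 - 3 / 4 * e` is above `U 1` and finally below the barrier, with room `e / 4` for
  -- the convergence of `S (Λ (r * t))`.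
  refine h.tendsto_of_eventually_ge hΛ hr hx (q := S 1 - 3 / 4 * e) ?_ ?_
  · linarith [hle 1 one_mem]
  · filter_upwards [hlimS1.eventually_const_lt (by linarith : S 1 - e / 4 < S 1)] with t ht
    exact le_trans (EReal.coe_le_coe_iff.2 (by linarith)) (hbarrier t)

theorem limit_eq (h : IsBistable f f' S U p) (hΛ : IsParameterShift 0 1 Λ) {r : ℝ} (hr : 0 < r)
    {Y Z : EReal} (hY : PullbackLimit f Λ r (S 0) Y) (hZ : PullbackLimit f Λ r (S 0) Z) :
    Y = Z :=
  hY.unique h.toIsRegularField hΛ hr (h.deriv_neg 0 zero_mem) hZ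

/-- At a common small rate, tracking and uniqueness of the future limit force the supposed tipping
target to be `S 1`, which is connected to `S 0` along the branch. -/
theorem not_bTipping (h : IsBistable f f' S U p) (hΛ : IsParameterShift 0 1 Λ) :
    ¬ BTipping f 0 1 Λ (S 0) := by
  rintro ⟨-, Xp, -, ⟨r₁, hr₁, hlim₁⟩, hnot⟩
  obtain ⟨r₂, hr₂, hlim₂⟩ := h.tracking hΛ
  have hm : 0 < min r₁ r₂ := lt_min hr₁ hr₂
  have h1 : min r₁ r₂ / 2 < r₁ := (half_lt_self hm).trans_le (min_le_left _ _)
  have h2 : min r₁ r₂ / 2 < r₂ := (half_lt_self hm).trans_le (min_le_right _ _)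
  have := h.limit_eq hΛ (half_pos hm) (hlim₁ _ (half_pos hm) h1) (hlim₂ _ (half_pos hm) h2)
  rw [this] at hnot
  exact hnot (h.lambdaConnected hΛ)

/-- A forward basin stable branch admits no irreversible R-tipping. -/
theorem not_irreversibleRTipping (h : IsBistable f f' S U p)
    (hUS : ∀ μ ∈ Icc (0 : ℝ) 1, ∀ ν ∈ Icc (0 : ℝ) 1, U ν < S μ) (hΛ : IsParameterShift 0 1 Λ) :
    ¬ IrreversibleRTipping f 0 1 Λ (S 0) := by
  obtain ⟨μ₀, hμ₀, hmin⟩ := isCompact_Icc.exists_isMinOn ⟨0, zero_mem⟩ h.contDiffOn.continuousOn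
  obtain ⟨ν₀, hν₀, hmax⟩ := isCompact_Icc.exists_isMaxOn ⟨0, zero_mem⟩ h.continuousOn_U
  -- By compactness one level `q` lies between all of `U` and all of `S`, so the field points
  -- upwards there at every parameter.
  obtain ⟨q, hq1, hq2⟩ := exists_between (hUS μ₀ hμ₀ ν₀ hν₀)
  have hUq : ∀ l ∈ Icc (0 : ℝ) 1, U l < q := fun l hl => lt_of_le_of_lt (hmax hl) hq1
  have hqS : ∀ l ∈ Icc (0 : ℝ) 1, q < S l := fun l hl => lt_of_lt_of_le hq2 (hmin hl)
  have hall : ∀ r, 0 < r → PullbackLimit f Λ r (S 0) (S 1) := by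
    intro r hr
    obtain ⟨x, hx⟩ := h.exists_pullback hΛ hr
    refine ⟨x, hx, h.tendsto_of_eventually_ge hΛ hr hx (hUq 1 one_mem)
      (Eventually.of_forall fun t => ?_)⟩
    obtain ⟨s, hs, hst⟩ := ((hx.2.eventually_const_lt
      (EReal.coe_lt_coe_iff.2 (hqS 0 zero_mem))).and (eventually_le_atBot t)).exists
    exact hx.1.const_le hst (fun u _ => h.pos_between _ (hΛ.mem_Icc _) _ (hUq _ (hΛ.mem_Icc _))
      (hqS _ (hΛ.mem_Icc _))) hs.le
  rintro ⟨-, r₀, hr₀, Xp, -, hlim, Yp, hne, hYp⟩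
  have h1 := h.limit_eq hΛ (half_pos hr₀) (hlim _ (half_pos hr₀) (half_lt_self hr₀))
    (hall _ (half_pos hr₀))
  have h2 := h.limit_eq hΛ hr₀ hYp (hall r₀ hr₀)
  exact hne (h2.trans h1.symm)

/-- The set of rates for which the pullback attractor tracks the stable branch is open. -/
theorem eventually_pullbackLimit (h : IsBistable f f' S U p) (hΛ : IsParameterShift 0 1 Λ)
    {r₀ : ℝ} (hr₀ : 0 < r₀) (hlim : PullbackLimit f Λ r₀ (S 0) (S 1)) :
    ∀ᶠ r in 𝓝 r₀, PullbackLimit f Λ r (S 0) (S 1) := by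
  obtain ⟨y, hy, hyl⟩ := hlim
  -- The reference trajectory exceeds `q'` at a time `T` after which `q` can only be crossed
  -- upwards. The gap `q' - q` is the error allowed to nearby rates at the matching time `r₀ / r *
  -- T`.
  obtain ⟨q, hq1, hq2⟩ := exists_between (h.U_lt_S 1 one_mem)
  obtain ⟨q', hq1', hq2'⟩ := exists_between hq2
  have hpos := h.pos_between 1 one_mem q hq1 hq2
  have hev := (h.toIsRegularField.tendsto_field one_mem (tendsto_const_nhds (x := q))
    (hΛ.tendsto_mul_atTop one_pos)).eventually_const_lt hpos
  obtain ⟨s₁, hs₁⟩ := eventually_atTop.1 hev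
  obtain ⟨T, hT, hTs⟩ := ((hyl.eventually_const_lt (EReal.coe_lt_coe_iff.2 hq2')).and
    (eventually_ge_atTop (s₁ / r₀))).exists
  rw [div_le_iff₀ hr₀] at hTs
  have hTbot : y T ≠ ⊥ := (lt_of_le_of_lt bot_le hT).ne'
  have hTreal : q' < (y T).toReal := by
    rwa [← EReal.coe_toReal (hy.1.ne_top T) hTbot, EReal.coe_lt_coe_iff] at hT
  filter_upwards [h.toIsRegularField.eventually_sub_le_pullback hΛ hr₀ (h.deriv_neg 0 zero_mem)
    hy hTbot (sub_pos.2 hq1'), lt_mem_nhds hr₀] with r hr hr0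
  obtain ⟨x, hx⟩ := h.exists_pullback hΛ hr0
  refine ⟨x, hx, h.tendsto_of_eventually_ge hΛ hr0 hx hq1 ?_⟩
  filter_upwards [eventually_ge_atTop (r₀ / r * T)] with t ht
  refine hx.1.const_le ht (fun u hu => ?_) (le_trans (EReal.coe_le_coe_iff.2 (by linarith))
    (hr x hx))
  have := hs₁ (r * u) ?_
  · simpa using this
  · have h1 : r * (r₀ / r * T) ≤ r * u := mul_le_mul_of_nonneg_left hu.1 hr0.le
    have h2 : r * (r₀ / r * T) = T * r₀ := by field_simp
    linarith

/-- If the pullback attractor fails to track at some rate, there is irreversible R-tipping (at the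
smallest such rate). -/
theorem irreversibleRTipping_of_not_tracking (h : IsBistable f f' S U p)
    (hΛ : IsParameterShift 0 1 Λ) {r₁ : ℝ} (hr₁ : 0 < r₁)
    (hnot : ¬ PullbackLimit f Λ r₁ (S 0) (S 1)) : IrreversibleRTipping f 0 1 Λ (S 0) := by
  obtain ⟨r₂, hr₂, htrack⟩ := h.tracking hΛ
  set B : Set ℝ := {r | 0 < r ∧ ¬ PullbackLimit f Λ r (S 0) (S 1)} with hB
  have hne : B.Nonempty := ⟨r₁, hr₁, hnot⟩
  have hlow : ∀ r ∈ B, r₂ ≤ r := by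
    intro r hr
    by_contra! hlt
    exact hr.2 (htrack r hr.1 hlt)
  have hbdd : BddBelow B := ⟨r₂, hlow⟩
  set r₀ := sInf B with hr₀
  have hr₀pos : 0 < r₀ := hr₂.trans_le (le_csInf hne hlow)
  -- The infimum is a limit of failing rates, and tracking there would persist nearby.
  have hr₀not : ¬ PullbackLimit f Λ r₀ (S 0) (S 1) := by
    intro hlim
    have hev := h.eventually_pullbackLimit hΛ hr₀pos hlim
    have hfr := mem_closure_iff_frequently.1 (csInf_mem_closure hne hbdd)
    obtain ⟨r, hr, hr'⟩ := (hfr.and_eventually hev).exists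
    exact hr.2 hr'
  refine ⟨h.stable zero_mem, r₀, hr₀pos, S 1, h.lambdaConnected hΛ, fun r hr hlt => ?_, ?_⟩
  · by_contra hn
    exact absurd (csInf_le hbdd ⟨hr, hn⟩) (not_le.2 hlt)
  · obtain ⟨x, hx⟩ := h.exists_pullback hΛ hr₀pos
    obtain ⟨L, hL⟩ := hx.1.exists_tendsto h.toIsRegularField (Or.inl rfl) one_mem
      (hΛ.tendsto_mul_atTop hr₀pos)
    refine ⟨L, ?_, x, hx, hL⟩
    rintro rfl
    exact hr₀not ⟨x, hx, hL⟩

end IsBistable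

/-! ### A parameter shift with two plateaus -/

section Glue

theorem hasDerivAt_expNegInvGlue (x : ℝ) :
    HasDerivAt expNegInvGlue ((x⁻¹) ^ 2 * expNegInvGlue x) x := by
  simpa using expNegInvGlue.hasDerivAt_polynomial_eval_inv_mul 1 x

theorem expNegInvGlue_lt_one (x : ℝ) : expNegInvGlue x < 1 := by
  rcases le_or_gt x 0 with h | h
  · rw [expNegInvGlue.zero_of_nonpos h]; exact one_pos
  · simp only [expNegInvGlue, not_le.2 h, if_false]
    rw [Real.exp_lt_one_iff]
    simpa using h

theorem tendsto_expNegInvGlue_atTop : Tendsto expNegInvGlue atTop (𝓝 1) := by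
  have h : Tendsto (fun x : ℝ => Real.exp (-x⁻¹)) atTop (𝓝 1) := by
    have := (Real.continuous_exp.tendsto (-0)).comp (tendsto_inv_atTop_zero (𝕜 := ℝ)).neg
    simpa using! this
  refine h.congr' ?_
  filter_upwards [eventually_gt_atTop (0 : ℝ)] with x hx
  simp [expNegInvGlue, not_le.2 hx]

theorem tendsto_deriv_expNegInvGlue_atTop :
    Tendsto (fun x : ℝ => (x⁻¹) ^ 2 * expNegInvGlue x) atTop (𝓝 0) := by
  simpa using ((tendsto_inv_atTop_zero (𝕜 := ℝ)).pow 2).mul tendsto_expNegInvGlue_atTop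

theorem expNegInvGlue_eventuallyEq_atBot : ∀ᶠ x in atBot, expNegInvGlue x = 0 := by
  filter_upwards [eventually_le_atBot (0 : ℝ)] with x hx using expNegInvGlue.zero_of_nonpos hx

/-- A parameter shift which rests at `μ` on `[-A, 0]`, then moves to `ν` within the time `δ`, and
rests there until the time `B`. -/
noncomputable def plateauShift (μ ν A δ B s : ℝ) : ℝ :=
  μ * (1 - expNegInvGlue (-(s + A))) + (ν - μ) * Real.smoothTransition (s / δ) +
    (1 - ν) * expNegInvGlue (s - B)

variable {μ ν A δ B : ℝ}

theorem plateauShift_eq_left (hδ : 0 < δ) (hB : 0 ≤ B) {s : ℝ} (hs : s ∈ Icc (-A) 0) :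
    plateauShift μ ν A δ B s = μ := by
  rw [plateauShift, expNegInvGlue.zero_of_nonpos (by linarith [hs.1]),
    Real.smoothTransition.zero_of_nonpos (div_nonpos_of_nonpos_of_nonneg hs.2 hδ.le),
    expNegInvGlue.zero_of_nonpos (by linarith [hs.2])]
  ring

theorem plateauShift_eq_right (hδ : 0 < δ) (hA : 0 ≤ A) {s : ℝ} (hs : s ∈ Icc δ B) :
    plateauShift μ ν A δ B s = ν := by
  rw [plateauShift, expNegInvGlue.zero_of_nonpos (by linarith [hs.1]),
    Real.smoothTransition.one_of_one_le ((one_le_div hδ).2 hs.1),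
    expNegInvGlue.zero_of_nonpos (by linarith [hs.2])]
  ring

/-- The shift sums steps of heights `μ`, `ν - μ` and `1 - ν`. The values stay strictly inside `(0,
1)` because `expNegInvGlue` never reaches `1`. The outer steps flatten since `x⁻² * exp (-1/x)`
tends to `0` at infinity, and the middle one is constant outside `[0, δ]`. -/
theorem isParameterShift_plateauShift (hμ : 0 < μ) (hμν : μ < ν) (hν : ν < 1) (hδ : 0 < δ) :
    IsParameterShift 0 1 (plateauShift μ ν A δ B) := by
  have hneg : Tendsto (fun s : ℝ => -(s + A)) atBot atTop :=
    tendsto_neg_atBot_atTop.comp (tendsto_atBot_add_const_right _ _ tendsto_id)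
  have hneg' : Tendsto (fun s : ℝ => -(s + A)) atTop atBot :=
    tendsto_neg_atTop_atBot.comp (tendsto_atTop_add_const_right _ _ tendsto_id)
  have hsub : Tendsto (fun s : ℝ => s - B) atBot atBot :=
    tendsto_atBot_add_const_right _ (-B) tendsto_id
  have hsub' : Tendsto (fun s : ℝ => s - B) atTop atTop :=
    tendsto_atTop_add_const_right _ (-B) tendsto_id
  have hst0 : ∀ᶠ s : ℝ in atBot, Real.smoothTransition (s / δ) = 0 := by
    filter_upwards [eventually_le_atBot (0 : ℝ)] with s hs
    exact Real.smoothTransition.zero_of_nonpos (div_nonpos_of_nonpos_of_nonneg hs hδ.le)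
  have hst1 : ∀ᶠ s : ℝ in atTop, Real.smoothTransition (s / δ) = 1 := by
    filter_upwards [eventually_ge_atTop δ] with s hs
    exact Real.smoothTransition.one_of_one_le ((one_le_div hδ).2 hs)
  have hst : Differentiable ℝ fun s : ℝ => Real.smoothTransition (s / δ) :=
    ((Real.smoothTransition.contDiff (n := 1)).comp
      (contDiff_id.div_const δ)).differentiable (by norm_num)
  have hder0 : ∀ᶠ s : ℝ in atBot, deriv (fun s : ℝ => Real.smoothTransition (s / δ)) s = 0 := by
    filter_upwards [eventually_lt_atBot (0 : ℝ)] with s hs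
    have : (fun s : ℝ => Real.smoothTransition (s / δ)) =ᶠ[𝓝 s] fun _ => 0 := by
      filter_upwards [gt_mem_nhds hs] with u hu
      exact Real.smoothTransition.zero_of_nonpos (div_nonpos_of_nonpos_of_nonneg hu.le hδ.le)
    rw [this.deriv_eq, deriv_const]
  have hder1 : ∀ᶠ s : ℝ in atTop, deriv (fun s : ℝ => Real.smoothTransition (s / δ)) s = 0 := by
    filter_upwards [eventually_gt_atTop δ] with s hs
    have : (fun s : ℝ => Real.smoothTransition (s / δ)) =ᶠ[𝓝 s] fun _ => 1 := by
      filter_upwards [lt_mem_nhds hs] with u hu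
      exact Real.smoothTransition.one_of_one_le ((one_le_div hδ).2 hu.le)
    rw [this.deriv_eq, deriv_const]
  let e' : ℝ → ℝ := fun x => (x⁻¹) ^ 2 * expNegInvGlue x
  have hderiv : deriv (plateauShift μ ν A δ B) = fun s => μ * e' (-(s + A)) +
      (ν - μ) * deriv (fun s : ℝ => Real.smoothTransition (s / δ)) s + (1 - ν) * e' (s - B) := by
    funext s
    have h1 : HasDerivAt (fun s => μ * (1 - expNegInvGlue (-(s + A)))) (μ * e' (-(s + A))) s := by
      have := (((hasDerivAt_expNegInvGlue (-(s + A))).comp s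
        ((hasDerivAt_id s).add_const A).neg).const_sub 1).const_mul μ
      convert! this using 1
      simp [e']
    have h3 : HasDerivAt (fun s => (1 - ν) * expNegInvGlue (s - B)) ((1 - ν) * e' (s - B)) s := by
      have := ((hasDerivAt_expNegInvGlue (s - B)).comp s
        ((hasDerivAt_id s).sub_const B)).const_mul (1 - ν)
      convert! this using 1
      simp [e']
    exact ((h1.add ((hst s).hasDerivAt.const_mul (ν - μ))).add h3).deriv
  have he'0 : Tendsto e' atBot (𝓝 0) := by
    refine tendsto_const_nhds.congr' ?_
    filter_upwards [expNegInvGlue_eventuallyEq_atBot] with x hx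
    simp [e', hx]
  have he'1 : Tendsto e' atTop (𝓝 0) := tendsto_deriv_expNegInvGlue_atTop
  have he0 : Tendsto expNegInvGlue atBot (𝓝 0) :=
    tendsto_const_nhds.congr' (expNegInvGlue_eventuallyEq_atBot.mono fun _ h => h.symm)
  refine ⟨?_, fun s => ?_, ?_, ?_, ?_, ?_⟩
  · have h1 : ContDiff ℝ 2 fun s : ℝ => expNegInvGlue (-(s + A)) :=
      (expNegInvGlue.contDiff (n := 2)).comp (contDiff_id.add contDiff_const).neg
    have h2 : ContDiff ℝ 2 fun s : ℝ => Real.smoothTransition (s / δ) :=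
      (Real.smoothTransition.contDiff (n := 2)).comp (contDiff_id.div_const δ)
    have h3 : ContDiff ℝ 2 fun s : ℝ => expNegInvGlue (s - B) :=
      (expNegInvGlue.contDiff (n := 2)).comp (contDiff_id.sub contDiff_const)
    exact ((contDiff_const.mul (contDiff_const.sub h1)).add (contDiff_const.mul h2)).add
      (contDiff_const.mul h3)
  · have h1 := expNegInvGlue_lt_one (-(s + A))
    have h1' := expNegInvGlue.nonneg (-(s + A))
    have h2 := Real.smoothTransition.nonneg (s / δ)
    have h2' := Real.smoothTransition.le_one (s / δ)
    have h3 := expNegInvGlue_lt_one (s - B)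
    have h3' := expNegInvGlue.nonneg (s - B)
    rw [plateauShift]
    constructor
    · have a1 := mul_pos hμ (sub_pos.2 h1)
      have a2 := mul_nonneg (sub_pos.2 hμν).le h2
      have a3 := mul_nonneg (sub_pos.2 hν).le h3'
      linarith
    · have a1 := mul_nonneg hμ.le h1'
      have a2 := mul_nonneg (sub_pos.2 hμν).le (sub_nonneg.2 h2')
      have a3 := mul_pos (sub_pos.2 hν) (sub_pos.2 h3)
      linarith
  · have := (((tendsto_expNegInvGlue_atTop.comp hneg).const_sub 1).const_mul μ).add
      ((tendsto_const_nhds.congr' (hst0.mono fun _ h => h.symm)).const_mul (ν - μ)) |>.add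
      ((he0.comp hsub).const_mul (1 - ν))
    simp only [Function.comp_def, sub_self, mul_zero, add_zero] at this
    exact this
  · have := (((he0.comp hneg').const_sub 1).const_mul μ).add
      ((tendsto_const_nhds.congr' (hst1.mono fun _ h => h.symm)).const_mul (ν - μ)) |>.add
      ((tendsto_expNegInvGlue_atTop.comp hsub').const_mul (1 - ν))
    rw [show μ * (1 - 0) + (ν - μ) * 1 + (1 - ν) * 1 = 1 by ring] at this
    exact this
  · rw [hderiv]
    have := ((he'1.comp hneg).const_mul μ).add
      ((tendsto_const_nhds.congr' (hder0.mono fun _ h => h.symm)).const_mul (ν - μ)) |>.add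
      ((he'0.comp hsub).const_mul (1 - ν))
    simpa using! this
  · rw [hderiv]
    have := ((he'0.comp hneg').const_mul μ).add
      ((tendsto_const_nhds.congr' (hder1.mono fun _ h => h.symm)).const_mul (ν - μ)) |>.add
      ((he'1.comp hsub').const_mul (1 - ν))
    simpa using! this

end Glue

/-! ### Constructing irreversible R-tipping -/

variable {f f' : ℝ → ℝ → ℝ} {Λ : ℝ → ℝ}

/-- A trajectory at unit rate passes from below `c₀` to below `c₁` within the time interval
`[t₀, t₁]` if the field is below the slope of the connecting segment along this segment. -/
theorem IsTrajectory.le_of_segment {x : ℝ → EReal} (hx : IsTrajectory f Λ 1 x) {k t₀ t₁ c₀ : ℝ}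
    (h01 : t₀ ≤ t₁) (hlt : ∀ t ∈ Icc t₀ t₁, f (c₀ + k * (t - t₀)) (Λ t) < k)
    (h₀ : x t₀ ≤ (c₀ : EReal)) : x t₁ ≤ ((c₀ + k * (t₁ - t₀) : ℝ) : EReal) := by
  refine hx.le_of_upper_barrier (c := fun t => c₀ + k * (t - t₀)) (c' := fun _ => k)
    (fun t _ => ?_) (fun t ht => ?_) ?_ t₁ ⟨h01, le_rfl⟩
  · simpa using (((hasDerivAt_id t).sub_const t₀).const_mul k).const_add c₀
  · rw [one_mul]; exact hlt t ht
  · simpa using h₀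

/-- A decreasing state follows a field bounded by `-η` down through a compact interval. -/
theorem IsTrajectory.le_of_neg_interval {x : ℝ → EReal} (hx : IsTrajectory f Λ 1 x)
    {η l t₀ a b : ℝ} (hη : 0 < η) (hab : a ≤ b) (hf : ∀ y ∈ Icc a b, f y l ≤ -η)
    (hΛ : ∀ t ∈ Icc t₀ (t₀ + 2 * (b - a) / η), Λ t = l) (h₀ : x t₀ ≤ (b : EReal)) :
    x (t₀ + 2 * (b - a) / η) ≤ (a : EReal) := by
  have hnn : 0 ≤ 2 * (b - a) / η := div_nonneg (by linarith) hη.le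
  -- Half the available speed keeps the comparison strict; hence the factor `2` in the time.
  have := hx.le_of_segment (k := -η / 2) (le_add_of_nonneg_right hnn) (fun t ht => ?_) h₀
  · convert this using 2
    field_simp
    ring
  · rw [hΛ t ht]
    refine (hf _ ⟨?_, ?_⟩).trans_lt (by linarith)
    · have h1 : η / 2 * (t - t₀) ≤ η / 2 * (2 * (b - a) / η) := by
        gcongr; linarith [ht.2]
      have h2 : η / 2 * (2 * (b - a) / η) = b - a := by field_simp
      linarith
    · have := mul_nonneg (half_pos hη).le (sub_nonneg.2 ht.1)
      linarith

namespace IsBistable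

variable {S U : ℝ → ℝ} {p : ℝ}

/-- If the stable branch at an earlier parameter value lies below the unstable branch at a later
one, then some parameter shift produces irreversible R-tipping. -/
theorem exists_irreversibleRTipping (h : IsBistable f f' S U p) {μ ν : ℝ} (hμ : 0 < μ)
    (hμν : μ < ν) (hν : ν < 1) (hSU : S μ < U ν) :
    ∃ Λ, IsParameterShift 0 1 Λ ∧ IrreversibleRTipping f 0 1 Λ (S 0) := by
  have hμI : μ ∈ Icc (0 : ℝ) 1 := ⟨hμ.le, (hμν.trans hν).le⟩
  have hνI : ν ∈ Icc (0 : ℝ) 1 := ⟨(hμ.trans hμν).le, hν.le⟩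
  obtain ⟨p₁, hp₁, hp₁'⟩ := exists_between hSU
  obtain ⟨p₂, hp₂, hp₂'⟩ := exists_between (max_lt hp₁' (h.floor_lt ν hνI))
  have hp12 : p₁ < p₂ := (le_max_left _ _).trans_lt hp₂
  have hpp₂ : p < p₂ := (le_max_right _ _).trans_lt hp₂
  obtain ⟨M, hp₁M, hSM, hM⟩ := h.exists_ceiling p₁
  have hcont : ∀ l ∈ Icc (0 : ℝ) 1, Continuous fun y => f y l := fun l hl =>
    continuous_iff_continuousAt.2 fun y => (h.hasDerivAt l hl y).continuousAt
  obtain ⟨η₁, hη₁, hη₁f⟩ := (isCompact_Icc (a := p₁) (b := M)).exists_forall_le'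
    (f := fun y => -f y μ) (hcont μ hμI).neg.continuousOn (a := 0) fun y hy =>
      neg_pos.2 (h.neg_above μ hμI y (hp₁.trans_le hy.1))
  obtain ⟨η₃, hη₃, hη₃f⟩ := (isCompact_Icc (a := p) (b := p₂)).exists_forall_le'
    (f := fun y => -f y ν) (hcont ν hνI).neg.continuousOn (a := 0) fun y hy =>
      neg_pos.2 (h.neg_below ν hνI y hy.1 (hy.2.trans_lt hp₂'))
  obtain ⟨C, hC, hCf⟩ := h.toIsRegularField.exists_bound (max |p₁| |p₂|)
  -- `A` is the time to fall from the ceiling `M` to `p₁` at parameter `μ`. During `δ` the state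
  -- cannot rise from `p₁` past `p₂`, as the field there is below `C + 1`. The rest of `B` is the
  -- time to fall from `p₂ < U ν` to the floor `p` at parameter `ν`.
  set A := 2 * (M - p₁) / η₁ with hA
  set δ := (p₂ - p₁) / (C + 1) with hδ
  set B := δ + 2 * (p₂ - p) / η₃ with hB
  have hA0 : 0 < A := div_pos (by linarith) hη₁
  have hδ0 : 0 < δ := div_pos (by linarith) (by linarith)
  have hB0 : δ < B := by
    have : 0 < 2 * (p₂ - p) / η₃ := div_pos (by linarith) hη₃
    linarith
  have hΛ : IsParameterShift 0 1 (plateauShift μ ν A δ B) :=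
    isParameterShift_plateauShift hμ hμν hν hδ0
  refine ⟨_, hΛ, h.irreversibleRTipping_of_not_tracking hΛ one_pos ?_⟩
  rintro ⟨x, hx, hlim⟩
  have h1 : x 0 ≤ (p₁ : EReal) := by
    have := hx.1.le_of_neg_interval (l := μ) (t₀ := -A) hη₁ hp₁M.le
      (fun y hy => by linarith [hη₁f y hy])
      (fun t ht => plateauShift_eq_left hδ0 (hδ0.trans hB0).le ⟨ht.1, by
        have := ht.2
        rw [← hA] at this
        linarith⟩)
      (hx.le_of_neg hΛ hM hSM _)
    rwa [← hA, neg_add_cancel] at this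
  have h2 : x δ ≤ (p₂ : EReal) := by
    have hC1 : (C + 1) * δ = p₂ - p₁ := by rw [hδ]; field_simp
    have := hx.1.le_of_segment (k := C + 1) hδ0.le (fun t ht => ?_) h1
    · rwa [sub_zero, hC1, add_sub_cancel] at this
    · rw [sub_zero]
      have hm1 : 0 ≤ (C + 1) * t := mul_nonneg (by linarith) ht.1
      have hm2 : (C + 1) * t ≤ (C + 1) * δ := mul_le_mul_of_nonneg_left ht.2 (by linarith)
      have := hCf _ (hΛ.mem_Icc t) (p₁ + (C + 1) * t)
        ⟨by linarith [neg_abs_le p₁, le_max_left |p₁| |p₂|],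
          by linarith [le_abs_self p₂, le_max_right |p₁| |p₂|]⟩
      linarith [le_abs_self (f (p₁ + (C + 1) * t) (plateauShift μ ν A δ B t))]
  have h3 : x B ≤ (p : EReal) :=
    hx.1.le_of_neg_interval (l := ν) hη₃ hpp₂.le (fun y hy => by linarith [hη₃f y hy])
      (fun t ht => plateauShift_eq_right hδ0 hA0.le ht) h2
  -- The floor is below `U` at every parameter, so it is never crossed upwards again.
  have h4 : (S 1 : EReal) ≤ p := by
    refine le_of_tendsto hlim ?_
    filter_upwards [eventually_ge_atTop B] with t ht
    exact hx.1.le_const ht (fun u _ => h.neg_below _ (hΛ.mem_Icc _) p le_rfl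
      (h.floor_lt _ (hΛ.mem_Icc _))) h3
  rw [EReal.coe_le_coe_iff] at h4
  linarith [h.floor_lt 1 one_mem, h.U_lt_S 1 one_mem]

end IsBistable

/-! ### B-tipping by slow passage through a gap without real equilibria -/

/-- If no real equilibria exist near some intermediate parameter value, every parameter shift
produces B-tipping. -/
theorem IsRegularField.bTipping (hf : IsRegularField f f') (hΛ : IsParameterShift 0 1 Λ) {S₀ : ℝ}
    (hS : f S₀ 0 = 0) (hneg : f' S₀ 0 < 0) {μ κ : ℝ} (hμ : μ ∈ Ioo (0 : ℝ) 1) (hκ : 0 < κ)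
    (hev : ∀ᶠ l in 𝓝 μ, ∀ y, f y l ≤ -κ * (1 + y ^ 2)) : BTipping f 0 1 Λ S₀ := by
  have h0 : (0 : ℝ) ∈ Icc (0 : ℝ) 1 := ⟨le_rfl, zero_le_one⟩
  obtain ⟨M, hM0, hM⟩ := hf.neg_of_large
  obtain ⟨s₀, hs₀⟩ : ∃ s, Λ s = μ := mem_range_of_exists_le_of_exists_ge hΛ.continuous
    (hΛ.tendsto_atBot.eventually_le_const hμ.1).exists
    (hΛ.tendsto_atTop.eventually_const_le hμ.2).exists
  refine ⟨hf.mem_stableEquilibria h0 hS hneg, ⊥, ?_, ?_, ?_⟩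
  · refine ⟨⟨zero_le_one, le_rfl⟩, Or.inr ⟨rfl, ?_⟩⟩
    filter_upwards [eventually_le_atBot (-M)] with y hy
    exact hM 1 ⟨zero_le_one, le_rfl⟩ y (le_trans (by linarith) (neg_le_abs y))
  · have hevs : ∀ᶠ s in 𝓝 s₀, ∀ y, f y (Λ s) ≤ -κ * (1 + y ^ 2) := by
      have h := hΛ.continuous.tendsto s₀
      rw [hs₀] at h
      exact h.eventually hev
    obtain ⟨d, hd, hball⟩ := Metric.nhds_basis_closedBall.eventually_iff.1 hevs
    rw [Real.closedBall_eq_Icc] at hball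
    -- In the gap `arctan x` decreases at rate at least `κ`, for a time `d / r`. It can lose less
    -- than `π` while `x` is finite, so `κ * d / r > π` forces `⊥`.
    refine ⟨κ * d / Real.pi, by positivity, fun r hr hrlt => ?_⟩
    obtain ⟨x, hx⟩ := hf.exists_pullback hΛ hr hS hneg
    refine ⟨x, hx, ?_⟩
    set t₀ := s₀ / r with ht₀
    set t₁ := (s₀ + d) / r with ht₁
    have htt : t₁ - t₀ = d / r := by rw [ht₀, ht₁]; ring
    have htt0 : t₀ < t₁ := by
      have : 0 < d / r := div_pos hd hr
      linarith
    have hbot : x t₁ = ⊥ := by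
      by_contra hne
      have hfin : ∀ t ∈ Icc t₀ t₁, x t ≠ ⊥ := fun t ht hb => hne (hx.1.absorbing t t₁ ht.2 hb)
      have hder : ∀ t ∈ Icc t₀ t₁, HasDerivAt (fun u => Real.arctan (x u).toReal)
          (1 / (1 + (x t).toReal ^ 2) * f (x t).toReal (Λ (r * t))) t := fun t ht =>
        (hx.1.hasDerivAt t (hfin t ht)).arctan
      have hdle : ∀ t ∈ Icc t₀ t₁,
          1 / (1 + (x t).toReal ^ 2) * f (x t).toReal (Λ (r * t)) ≤ -κ := by
        intro t ht
        have h1 : r * t ∈ Icc (s₀ - d) (s₀ + d) := by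
          have a1 : s₀ ≤ r * t := by
            have := (div_le_iff₀ hr).1 ht.1; linarith
          have a2 : r * t ≤ s₀ + d := by
            have := (le_div_iff₀ hr).1 ht.2; linarith
          exact ⟨by linarith, a2⟩
        have h2 := hball h1 (x t).toReal
        have h3 : 0 < 1 + (x t).toReal ^ 2 := by positivity
        rw [one_div_mul_eq_div, div_le_iff₀ h3]
        exact h2
      have := (convex_Icc t₀ t₁).image_sub_le_mul_sub_of_deriv_le
        (f := fun u => Real.arctan (x u).toReal) (C := -κ)
        (fun t ht => (hder t ht).continuousAt.continuousWithinAt)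
        (fun t ht => (hder t (interior_subset ht)).differentiableAt.differentiableWithinAt)
        (fun t ht => by
          rw [(hder t (interior_subset ht)).deriv]; exact hdle t (interior_subset ht))
        t₀ ⟨le_rfl, htt0.le⟩ t₁ ⟨htt0.le, le_rfl⟩ htt0.le
      rw [htt] at this
      have h1 := Real.arctan_lt_pi_div_two (x t₀).toReal
      have h2 := Real.neg_pi_div_two_lt_arctan (x t₁).toReal
      have h3 : Real.pi < κ * (d / r) := by
        rw [lt_div_iff₀ Real.pi_pos] at hrlt
        rw [← mul_div_assoc, lt_div_iff₀ hr]
        linarith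
      linarith
    refine tendsto_const_nhds.congr' ?_
    filter_upwards [eventually_ge_atTop t₁] with t ht
    exact (hx.1.absorbing t₁ t ht hbot).symm
  · rintro ⟨-, -, X, hX⟩
    -- Finite equilibria lie above `-M`, so `⊥` is isolated among the values of the path and `{s | X
    -- s = ⊥}` is clopen. It contains `s₀`, hence is the whole line, against the past limit `S₀`.
    have hval : ∀ s, X s = ⊥ ∨ ((-M : ℝ) : EReal) < X s := by
      intro s
      obtain ⟨hl, ⟨y, hy, hy0⟩ | hb⟩ := hX.mem_equilibria s
      · right
        simp only at hy hy0
        rw [hy, EReal.coe_lt_coe_iff]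
        by_contra! hle
        exact (hM _ (hΛ.mem_Icc s) y (le_trans (by linarith) (neg_le_abs y))).ne hy0
      · exact Or.inl hb
    have hclopen : IsClopen {s | X s = ⊥} := by
      refine ⟨isClosed_eq hX.continuous continuous_const, ?_⟩
      have : {s | X s = ⊥} = {s | X s < ((-M : ℝ) : EReal)} := by
        ext s
        refine ⟨fun h => ?_, fun h => (hval s).resolve_right (not_lt.2 (le_of_lt h))⟩
        rw [mem_ofPred_eq] at h ⊢
        rw [h]; exact EReal.bot_lt_coe _
      rw [this]
      exact isOpen_lt hX.continuous continuous_const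
    have hmem : s₀ ∈ {s | X s = ⊥} := by
      obtain ⟨hl, ⟨y, hy, hy0⟩ | hb⟩ := hX.mem_equilibria s₀
      · simp only at hy0
        rw [hs₀] at hy0
        have := hev.self_of_nhds y
        nlinarith [mul_pos hκ (by positivity : 0 < 1 + y ^ 2)]
      · exact hb
    have huniv := hclopen.eq_univ ⟨s₀, hmem⟩
    have hconst : X = fun _ => ⊥ := funext fun s => by
      have : s ∈ {s | X s = ⊥} := huniv ▸ mem_univ s
      exact this
    have hlim := hX.tendsto_atBot
    rw [hconst] at hlim
    exact EReal.bot_ne_coe S₀ (tendsto_nhds_unique tendsto_const_nhds hlim)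

/-! ### The quadratic in `X` and its two roots -/

variable {b c : ℝ → ℝ}

section Branches

variable {l : ℝ}

theorem Xs_add_Xu : Xs b c l + Xu b c l = b l := by
  rw [Xs, Xu]; ring

theorem Xs_sub_Xu : Xs b c l - Xu b c l = √(b l ^ 2 - 4 * c l) := by
  rw [Xs, Xu]; ring

theorem Xs_mul_Xu (h : 4 * c l ≤ b l ^ 2) : Xs b c l * Xu b c l = c l := by
  have := Real.sq_sqrt (sub_nonneg.2 h)
  rw [Xs, Xu]; linear_combination (-1 / 4) * this

theorem Xu_lt_Xs (h : 4 * c l < b l ^ 2) : Xu b c l < Xs b c l := by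
  have := Real.sqrt_pos.2 (sub_pos.2 h)
  rw [← sub_pos, Xs_sub_Xu]; exact this

theorem quadratic_eq (h : 4 * c l ≤ b l ^ 2) (X : ℝ) :
    -X ^ 2 + b l * X - c l = -((X - Xs b c l) * (X - Xu b c l)) := by
  rw [← Xs_mul_Xu h, ← Xs_add_Xu (b := b) (c := c) (l := l)]; ring

theorem quadratic_neg_of_gt (h : 4 * c l < b l ^ 2) {X : ℝ} (hX : Xs b c l < X) :
    -X ^ 2 + b l * X - c l < 0 := by
  rw [quadratic_eq h.le, neg_lt_zero]
  exact mul_pos (sub_pos.2 hX) (sub_pos.2 ((Xu_lt_Xs h).trans hX))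

theorem quadratic_pos (h : 4 * c l < b l ^ 2) {X : ℝ} (hX : Xu b c l < X) (hX' : X < Xs b c l) :
    0 < -X ^ 2 + b l * X - c l := by
  rw [quadratic_eq h.le, neg_pos]
  exact mul_neg_of_neg_of_pos (sub_neg.2 hX') (sub_pos.2 hX)

theorem quadratic_neg_of_lt (h : 4 * c l < b l ^ 2) {X : ℝ} (hX : X < Xu b c l) :
    -X ^ 2 + b l * X - c l < 0 := by
  rw [quadratic_eq h.le, neg_lt_zero]
  exact mul_pos_of_neg_of_neg (sub_neg.2 (hX.trans (Xu_lt_Xs h))) (sub_neg.2 hX)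

theorem contDiffOn_sqrt_discr (hb : ContDiffOn ℝ 2 b (Icc 0 1)) (hc : ContDiffOn ℝ 2 c (Icc 0 1))
    (h : ∀ l ∈ Icc (0 : ℝ) 1, 4 * c l < b l ^ 2) :
    ContDiffOn ℝ 2 (fun l => √(b l ^ 2 - 4 * c l)) (Icc 0 1) :=
  ((hb.pow 2).sub (contDiffOn_const.mul hc)).sqrt fun l hl => (sub_pos.2 (h l hl)).ne'

theorem contDiffOn_Xs (hb : ContDiffOn ℝ 2 b (Icc 0 1)) (hc : ContDiffOn ℝ 2 c (Icc 0 1))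
    (h : ∀ l ∈ Icc (0 : ℝ) 1, 4 * c l < b l ^ 2) : ContDiffOn ℝ 2 (Xs b c) (Icc 0 1) :=
  (hb.div_const 2).add ((contDiffOn_sqrt_discr hb hc h).div_const 2)

theorem contDiffOn_Xu (hb : ContDiffOn ℝ 2 b (Icc 0 1)) (hc : ContDiffOn ℝ 2 c (Icc 0 1))
    (h : ∀ l ∈ Icc (0 : ℝ) 1, 4 * c l < b l ^ 2) : ContDiffOn ℝ 2 (Xu b c) (Icc 0 1) :=
  (hb.div_const 2).sub ((contDiffOn_sqrt_discr hb hc h).div_const 2)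

/-- Large values of `X` are moved down, uniformly in the parameter. -/
theorem exists_quadratic_neg (hb : ContinuousOn b (Icc 0 1)) (hc : ContinuousOn c (Icc 0 1)) :
    ∃ M ≥ 1, ∀ l ∈ Icc (0 : ℝ) 1, ∀ X, M ≤ |X| → -X ^ 2 + b l * X - c l < 0 := by
  obtain ⟨B, hB⟩ := isCompact_Icc.exists_bound_of_continuousOn hb
  obtain ⟨C, hC⟩ := isCompact_Icc.exists_bound_of_continuousOn hc
  have hm : (0 : ℝ) ∈ Icc (0 : ℝ) 1 := ⟨le_rfl, zero_le_one⟩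
  have hB0 : 0 ≤ B := (norm_nonneg _).trans (hB 0 hm)
  have hC0 : 0 ≤ C := (norm_nonneg _).trans (hC 0 hm)
  refine ⟨B + C + 1, by linarith, fun l hl X hX => ?_⟩
  have h1 : b l * X ≤ B * |X| :=
    (le_abs_self _).trans (by rw [abs_mul]; gcongr; exact hB l hl)
  have h2 : -c l ≤ C := (neg_le_abs _).trans (hC l hl)
  have h3 : (B + C + 1) * |X| ≤ X ^ 2 := by
    rw [← sq_abs, sq]; gcongr
  have h4 : C * 1 ≤ C * |X| := by gcongr; linarith
  linarith

/-- Where the discriminant is negative, the field is uniformly and quadratically negative. -/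
theorem exists_eventually_quadratic_le {μ : ℝ} (hb : ContinuousAt b μ) (hc : ContinuousAt c μ)
    (h : b μ ^ 2 < 4 * c μ) :
    ∃ κ > 0, ∀ᶠ l in 𝓝 μ, ∀ X, -X ^ 2 + b l * X - c l ≤ -κ * (1 + X ^ 2) := by
  set e := 4 * c μ - b μ ^ 2 with he
  set D := 1 + (b μ ^ 2 + 1) / 2 with hD
  have he0 : 0 < e := by linarith
  have hD0 : 0 < D := by positivity
  -- Completing the square, near `μ` the quadratic is below `-(X - b/2)² - e/8`. Since `X² ≤ 2 (X -
  -- b/2)² + b²/2` and `D` bounds `1 + b²/2` nearby, `κ ≤ 1/2` handles the square and `κ * D ≤ e/8`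
  -- the constant.
  refine ⟨min (1 / 2) (e / 8 / D), by positivity, ?_⟩
  filter_upwards [((Tendsto.const_mul 4 hc).sub (Tendsto.pow hb 2)).eventually_const_lt (half_lt_self he0),
    (Tendsto.pow hb 2).eventually_lt_const (lt_add_one (b μ ^ 2))] with l h1 h2 X
  set κ := min (1 / 2) (e / 8 / D) with hκ
  have hκ0 : 0 < κ := by positivity
  have h3 : κ ≤ 1 / 2 := min_le_left _ _
  have h4 : κ * D ≤ e / 8 := (le_div_iff₀ hD0).1 (min_le_right _ _)
  have h5 : κ * (b l ^ 2) ≤ κ * (b μ ^ 2 + 1) := by gcongr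
  have h6 : κ * X ^ 2 ≤ κ * (2 * (X - b l / 2) ^ 2 + b l ^ 2 / 2) := by
    gcongr; nlinarith [sq_nonneg (X - b l)]
  have h7 : κ * (X - b l / 2) ^ 2 ≤ 1 / 2 * (X - b l / 2) ^ 2 := by gcongr
  simp only [hD] at h4
  nlinarith

end Branches

/-! ### Regularity of the two models -/

section Regularity

theorem continuousOn_snd_comp {g : ℝ → ℝ} (hg : ContinuousOn g (Icc 0 1)) :
    ContinuousOn (fun p : ℝ × ℝ => g p.2) (univ ×ˢ Icc (0 : ℝ) 1) :=
  hg.comp continuousOn_snd fun _ hp => hp.2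

theorem isRegularField_reduced (hb : ContinuousOn b (Icc 0 1)) (hc : ContinuousOn c (Icc 0 1)) :
    IsRegularField (reduced b c) (fun x l => -(2 * x) + b l) where
  hasDerivAt l _ x := by
    have := (((hasDerivAt_id x).pow 2).neg.add ((hasDerivAt_id x).const_mul (b l))).sub_const (c l)
    convert! this using 1
    simp
  continuousOn := by
    have h1 := continuousOn_snd_comp hb
    have h2 := continuousOn_snd_comp hc
    exact (((continuousOn_fst.pow 2).neg).add (h1.mul continuousOn_fst)).sub h2
  continuousOn' := ((continuousOn_const.mul continuousOn_fst).neg).add (continuousOn_snd_comp hb)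
  neg_of_large := by
    obtain ⟨M, hM1, hM⟩ := exists_quadratic_neg hb hc
    exact ⟨M, by linarith, hM⟩
  exists_ne_zero l _ p q hpq := by
    by_contra! h
    -- A second difference detects the leading coefficient of a quadratic.
    have h1 := h ((p + q) / 2) ⟨by linarith, by linarith⟩
    have h2 := h ((p + q) / 2 + (q - p) / 4) ⟨by linarith, by linarith⟩
    have h3 := h ((p + q) / 2 - (q - p) / 4) ⟨by linarith, by linarith⟩
    simp only [reduced] at h1 h2 h3
    have h4 : (q - p) ^ 2 = 0 := by linear_combination 16 * h1 - 8 * h2 - 8 * h3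
    have := pow_eq_zero_iff (two_ne_zero) |>.1 h4
    linarith

variable {a τ : ℝ}

theorem isRegularField_fraedrich (ha : 0 < a) (hτ : 0 < τ) (hb : ContinuousOn b (Icc 0 1))
    (hc : ContinuousOn c (Icc 0 1)) :
    IsRegularField (fraedrich a τ b c)
      (fun x l => τ⁻¹ * a * (-(4 * x ^ 3) + b l * (2 * x))) where
  hasDerivAt l _ x := by
    have := ((((hasDerivAt_id x).pow 4).neg.add
      (((hasDerivAt_id x).pow 2).const_mul (b l))).sub_const (c l)).const_mul (τ⁻¹ * a)
    convert! this using 1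
    simp
  continuousOn := by
    have h1 := continuousOn_snd_comp hb
    have h2 := continuousOn_snd_comp hc
    exact continuousOn_const.mul
      ((((continuousOn_fst.pow 4).neg).add (h1.mul (continuousOn_fst.pow 2))).sub h2)
  continuousOn' := continuousOn_const.mul
    (((continuousOn_const.mul (continuousOn_fst.pow 3)).neg).add
      ((continuousOn_snd_comp hb).mul (continuousOn_const.mul continuousOn_fst)))
  neg_of_large := by
    obtain ⟨M, hM1, hM⟩ := exists_quadratic_neg hb hc
    refine ⟨M, by linarith, fun l hl x hx => ?_⟩
    -- Here `M ≥ 1` matters: it gives `x ^ 2 ≥ |x|`.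
    have h1 : M ≤ |x ^ 2| := by
      rw [abs_pow, sq]
      nlinarith
    have h2 := hM l hl (x ^ 2) h1
    have hk : 0 < τ⁻¹ * a := by positivity
    refine mul_neg_of_pos_of_neg hk ?_
    linarith [h2, show x ^ 4 = (x ^ 2) ^ 2 by ring]
  exists_ne_zero l _ p q hpq := by
    by_contra! h
    have hk : τ⁻¹ * a ≠ 0 := by positivity
    have hz : ∀ x ∈ Ioo p q, -x ^ 4 + b l * x ^ 2 - c l = 0 := fun x hx =>
      (mul_eq_zero.1 (h x hx)).resolve_left hk
    -- The fourth difference of the quartic with step `d` is `-24 * d ^ 4`.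
    set m := (p + q) / 2 with hm
    set d := (q - p) / 8 with hd
    have h0 := hz m ⟨by linarith, by linarith⟩
    have h1 := hz (m + d) ⟨by linarith, by linarith⟩
    have h2 := hz (m - d) ⟨by linarith, by linarith⟩
    have h3 := hz (m + 2 * d) ⟨by linarith, by linarith⟩
    have h4 := hz (m - 2 * d) ⟨by linarith, by linarith⟩
    have h5 : d ^ 4 = 0 := by
      linear_combination (-1 / 24) * h3 + (-1 / 24) * h4 + (1 / 6) * h1 + (1 / 6) * h2
        + (-1 / 4) * h0
    have := pow_eq_zero_iff (four_ne_zero) |>.1 h5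
    linarith

end Regularity

/-! ### Bistability of the two models -/

section Bistable

/-- All states below the lower root fall, so any level below the minimum of `Xu` serves as the
floor. -/
theorem exists_isBistable_reduced (hb : ContDiffOn ℝ 2 b (Icc 0 1))
    (hc : ContDiffOn ℝ 2 c (Icc 0 1)) (h : ∀ l ∈ Icc (0 : ℝ) 1, 4 * c l < b l ^ 2) :
    ∃ p, IsBistable (reduced b c) (fun x l => -(2 * x) + b l) (Xs b c) (Xu b c) p := by
  have hU := (contDiffOn_Xu hb hc h).continuousOn
  obtain ⟨C, hC⟩ := isCompact_Icc.exists_bound_of_continuousOn hU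
  exact ⟨-C - 1,
    { toIsRegularField := isRegularField_reduced hb.continuousOn hc.continuousOn
      contDiffOn := contDiffOn_Xs hb hc h
      continuousOn_U := hU
      floor_lt := fun l hl => by linarith [(abs_le.1 (hC l hl)).1]
      U_lt_S := fun l hl => Xu_lt_Xs (h l hl)
      zero := fun l hl => by rw [reduced, quadratic_eq (h l hl).le]; ring
      deriv_neg := fun l hl => by
        rw [← Xs_add_Xu (b := b) (c := c) (l := l)]
        linarith [Xu_lt_Xs (h l hl)]
      neg_above := fun l hl x hx => quadratic_neg_of_gt (h l hl) hx
      pos_between := fun l hl x hx hx' => quadratic_pos (h l hl) hx hx'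
      neg_below := fun l hl x _ hx => quadratic_neg_of_lt (h l hl) hx }⟩

variable {a τ : ℝ}

theorem fraedrich_eq (x l : ℝ) :
    fraedrich a τ b c x l = τ⁻¹ * a * (-(x ^ 2) ^ 2 + b l * x ^ 2 - c l) := by
  rw [fraedrich]; ring

theorem fraedrich_sqrt_Xs {l : ℝ} (h : 4 * c l ≤ b l ^ 2) (hX : 0 ≤ Xs b c l) :
    fraedrich a τ b c (√(Xs b c l)) l = 0 := by
  rw [fraedrich_eq, Real.sq_sqrt hX, quadratic_eq h]; ring

/-- With `T² = Xs` the bracket is `2 T (b - 2 Xs) = 2 T (Xu - Xs)`. -/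
theorem deriv_fraedrich_sqrt_Xs_neg (ha : 0 < a) (hτ : 0 < τ) {l : ℝ} (h : 4 * c l < b l ^ 2)
    (hX : 0 < Xs b c l) :
    τ⁻¹ * a * (-(4 * √(Xs b c l) ^ 3) + b l * (2 * √(Xs b c l))) < 0 := by
  have hk : 0 < τ⁻¹ * a := by positivity
  refine mul_neg_of_pos_of_neg hk ?_
  have h1 : -(4 * √(Xs b c l) ^ 3) + b l * (2 * √(Xs b c l)) =
      2 * √(Xs b c l) * (Xu b c l - Xs b c l) := by
    have h2 := Real.sq_sqrt hX.le
    rw [← Xs_add_Xu (b := b) (c := c) (l := l)]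
    linear_combination (-4 * √(Xs b c l)) * h2
  rw [h1]
  exact mul_neg_of_pos_of_neg (mul_pos two_pos (Real.sqrt_pos.2 hX)) (sub_neg.2 (Xu_lt_Xs h))

/-- The field is even in `T`, so it is positive again between `-√Xs` and `-√Xu`. The floor `0` keeps
the sign pattern to nonnegative states. -/
theorem isBistable_fraedrich (ha : 0 < a) (hτ : 0 < τ) (hb : ContDiffOn ℝ 2 b (Icc 0 1))
    (hc : ContDiffOn ℝ 2 c (Icc 0 1)) (h : ∀ l ∈ Icc (0 : ℝ) 1, 4 * c l < b l ^ 2)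
    (hpos : ∀ l ∈ Icc (0 : ℝ) 1, 0 < Xu b c l) :
    IsBistable (fraedrich a τ b c) (fun x l => τ⁻¹ * a * (-(4 * x ^ 3) + b l * (2 * x)))
      (fun l => √(Xs b c l)) (fun l => √(Xu b c l)) 0 := by
  have hk : 0 < τ⁻¹ * a := by positivity
  have hXs : ∀ l ∈ Icc (0 : ℝ) 1, 0 < Xs b c l := fun l hl =>
    (hpos l hl).trans (Xu_lt_Xs (h l hl))
  exact
    { toIsRegularField := isRegularField_fraedrich ha hτ hb.continuousOn hc.continuousOn
      contDiffOn := (contDiffOn_Xs hb hc h).sqrt fun l hl => (hXs l hl).ne'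
      continuousOn_U := (contDiffOn_Xu hb hc h).continuousOn.sqrt
      floor_lt := fun l hl => Real.sqrt_pos.2 (hpos l hl)
      U_lt_S := fun l hl => Real.sqrt_lt_sqrt (hpos l hl).le (Xu_lt_Xs (h l hl))
      zero := fun l hl => fraedrich_sqrt_Xs (h l hl).le (hXs l hl).le
      deriv_neg := fun l hl => deriv_fraedrich_sqrt_Xs_neg ha hτ (h l hl) (hXs l hl)
      neg_above := fun l hl x hx => by
        rw [fraedrich_eq]
        refine mul_neg_of_pos_of_neg hk (quadratic_neg_of_gt (h l hl) ?_)
        exact (Real.sqrt_lt' ((Real.sqrt_nonneg _).trans_lt hx)).1 hx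
      pos_between := fun l hl x hx hx' => by
        rw [fraedrich_eq]
        have hx0 : 0 < x := (Real.sqrt_nonneg _).trans_lt hx
        exact mul_pos hk (quadratic_pos (h l hl) ((Real.sqrt_lt' hx0).1 hx)
          ((Real.lt_sqrt hx0.le).1 hx'))
      neg_below := fun l hl x hx hx' => by
        rw [fraedrich_eq]
        exact mul_neg_of_pos_of_neg hk (quadratic_neg_of_lt (h l hl) ((Real.lt_sqrt hx).1 hx')) }

end Bistable

/-- What the tipping results need to know about a model with right-hand side `f` and stable branch
`S`, expressed through the branches in the variable `X`. -/
structure IsModel (b c : ℝ → ℝ) (f f' : ℝ → ℝ → ℝ) (S : ℝ → ℝ) : Prop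
    extends IsRegularField f f' where
  zero : 4 * c 0 < b 0 ^ 2 → f (S 0) 0 = 0
  deriv_neg : 4 * c 0 < b 0 ^ 2 → f' (S 0) 0 < 0
  exists_isBistable : (∀ l ∈ Icc (0 : ℝ) 1, 4 * c l < b l ^ 2) →
    ∃ U p, IsBistable f f' S U p ∧ ∀ μ ∈ Icc (0 : ℝ) 1, ∀ ν ∈ Icc (0 : ℝ) 1,
      (Xu b c ν < Xs b c μ → U ν < S μ) ∧ (Xs b c μ < Xu b c ν → S μ < U ν)
  exists_eventually_le : ∀ μ ∈ Ioo (0 : ℝ) 1, b μ ^ 2 < 4 * c μ →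
    ∃ κ > 0, ∀ᶠ l in 𝓝 μ, ∀ y, f y l ≤ -κ * (1 + y ^ 2)

theorem isModel_reduced (hb : ContDiffOn ℝ 2 b (Icc 0 1)) (hc : ContDiffOn ℝ 2 c (Icc 0 1)) :
    IsModel b c (reduced b c) (fun x l => -(2 * x) + b l) (Xs b c) where
  toIsRegularField := isRegularField_reduced hb.continuousOn hc.continuousOn
  zero h := by rw [reduced, quadratic_eq h.le]; ring
  deriv_neg h := by
    rw [← Xs_add_Xu (b := b) (c := c) (l := 0)]
    linarith [Xu_lt_Xs h]
  exists_isBistable h := by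
    obtain ⟨p, hp⟩ := exists_isBistable_reduced hb hc h
    exact ⟨Xu b c, p, hp, fun μ _ ν _ => ⟨id, id⟩⟩
  exists_eventually_le μ hμ h :=
    exists_eventually_quadratic_le (hb.continuousOn.continuousAt (Icc_mem_nhds hμ.1 hμ.2))
      (hc.continuousOn.continuousAt (Icc_mem_nhds hμ.1 hμ.2)) h

theorem isModel_fraedrich {a τ : ℝ} (ha : 0 < a) (hτ : 0 < τ) (hb : ContDiffOn ℝ 2 b (Icc 0 1))
    (hc : ContDiffOn ℝ 2 c (Icc 0 1))
    (hpos : ∀ l ∈ Icc (0 : ℝ) 1, 4 * c l ≤ b l ^ 2 → 0 < Xu b c l) :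
    IsModel b c (fraedrich a τ b c) (fun x l => τ⁻¹ * a * (-(4 * x ^ 3) + b l * (2 * x)))
      (fun l => √(Xs b c l)) where
  toIsRegularField := isRegularField_fraedrich ha hτ hb.continuousOn hc.continuousOn
  zero h := fraedrich_sqrt_Xs h.le
    ((hpos 0 ⟨le_rfl, zero_le_one⟩ h.le).trans (Xu_lt_Xs h)).le
  deriv_neg h := deriv_fraedrich_sqrt_Xs_neg ha hτ h
    ((hpos 0 ⟨le_rfl, zero_le_one⟩ h.le).trans (Xu_lt_Xs h))
  exists_isBistable h := by
    have hXu : ∀ l ∈ Icc (0 : ℝ) 1, 0 < Xu b c l := fun l hl => hpos l hl (h l hl).le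
    refine ⟨_, 0, isBistable_fraedrich ha hτ hb hc h hXu, fun μ hμ ν hν =>
      ⟨Real.sqrt_lt_sqrt (hXu ν hν).le, Real.sqrt_lt_sqrt ?_⟩⟩
    exact ((hXu μ hμ).trans (Xu_lt_Xs (h μ hμ))).le
  exists_eventually_le μ hμ h := by
    obtain ⟨κ, hκ, hev⟩ := exists_eventually_quadratic_le
      (hb.continuousOn.continuousAt (Icc_mem_nhds hμ.1 hμ.2))
      (hc.continuousOn.continuousAt (Icc_mem_nhds hμ.1 hμ.2)) h
    have hk : 0 < τ⁻¹ * a := by positivity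
    -- The bound in `X = y²` involves `1 + y⁴`, which is at least `(1 + y²) / 2`; hence the half.
    refine ⟨τ⁻¹ * a * (κ / 2), by positivity, ?_⟩
    filter_upwards [hev] with l hl y
    rw [fraedrich_eq]
    calc τ⁻¹ * a * (-(y ^ 2) ^ 2 + b l * y ^ 2 - c l)
        ≤ τ⁻¹ * a * (-κ * (1 + (y ^ 2) ^ 2)) := by gcongr; exact hl _
      _ ≤ τ⁻¹ * a * (-κ * ((1 + y ^ 2) / 2)) := by
          refine mul_le_mul_of_nonneg_left ?_ hk.le
          refine mul_le_mul_of_nonpos_left ?_ (neg_nonpos.2 hκ.le)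
          nlinarith [sq_nonneg (y ^ 2 - 1)]
      _ = _ := by ring

/-- A comparison between the end points of the branches persists for nearby interior points. -/
theorem IsBistable.exists_lt_of_lt {f f' : ℝ → ℝ → ℝ} {S U : ℝ → ℝ} {p : ℝ}
    (h : IsBistable f f' S U p) (h01 : S 0 < U 1) :
    ∃ μ ν : ℝ, 0 < μ ∧ μ < ν ∧ ν < 1 ∧ S μ < U ν := by
  obtain ⟨q, hq1, hq2⟩ := exists_between h01
  have hS : ∀ᶠ l in 𝓝[>] (0 : ℝ), S l < q := by
    have := (h.contDiffOn.continuousOn 0 zero_mem).tendsto.eventually_lt_const hq1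
    rw [nhdsWithin_Icc_eq_nhdsGE zero_lt_one] at this
    exact this.filter_mono (nhdsWithin_mono _ Ioi_subset_Ici_self)
  have hU : ∀ᶠ l in 𝓝[<] (1 : ℝ), q < U l := by
    have := (h.continuousOn_U 1 one_mem).tendsto.eventually_const_lt hq2
    rw [nhdsWithin_Icc_eq_nhdsLE zero_lt_one] at this
    exact this.filter_mono (nhdsWithin_mono _ Iio_subset_Iic_self)
  obtain ⟨μ, hμ, hμI⟩ := (hS.and (Ioo_mem_nhdsGT (by norm_num : (0 : ℝ) < 1 / 2))).exists
  obtain ⟨ν, hν, hνI⟩ := (hU.and (Ioo_mem_nhdsLT (by norm_num : (1 / 2 : ℝ) < 1))).exists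
  exact ⟨μ, ν, hμI.1, hμI.2.trans hνI.1, hνI.2, hμ.trans hν⟩

end Tipping



/-! ### The theorem for both models -/

theorem theorem4p1 (a τ : ℝ) (ha : 0 < a) (hτ : 0 < τ) (b c : ℝ → ℝ)
    (hb : ContDiffOn ℝ 2 b (Set.Icc 0 1)) (hc : ContDiffOn ℝ 2 c (Set.Icc 0 1))
    -- `f` is the right-hand side and `S` the stable branch: either of the reduced model in the
    -- variable `X`, or of the original model in the variable `T = √X`, where both branches are to
    -- consist of positive `X` wherever they exist
    (f : ℝ → ℝ → ℝ) (S : ℝ → ℝ)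
    (hf : (f = Tipping.reduced b c ∧ S = Tipping.Xs b c) ∨
      (f = Tipping.fraedrich a τ b c ∧ (S = fun l => √(Tipping.Xs b c l)) ∧
        ∀ l ∈ Set.Icc (0 : ℝ) 1, 4 * c l ≤ b l ^ 2 → 0 < Tipping.Xu b c l)) :
    -- well-posedness of the notions below
    (4 * c 0 < b 0 ^ 2 →
      ((S 0 : EReal), (0 : ℝ)) ∈ Tipping.stableEquilibria f 0 1 ∧
      ∀ Λ, Tipping.IsParameterShift 0 1 Λ → ∀ r : ℝ, 0 < r →
        ∃! x, Tipping.IsPullbackTrajectory f Λ r (S 0) x) ∧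
    -- (a)
    ((∀ l ∈ Set.Icc (0 : ℝ) 1, 4 * c l < b l ^ 2) →
      Tipping.IsStableBranch f 0 1 S ∧
      ∀ Λ, Tipping.IsParameterShift 0 1 Λ → ¬ Tipping.BTipping f 0 1 Λ (S 0)) ∧
    -- (b)
    ((∀ l ∈ Set.Icc (0 : ℝ) 1, 4 * c l < b l ^ 2) →
      (∀ μ ∈ Set.Icc (0 : ℝ) 1, ∀ ν ∈ Set.Icc (0 : ℝ) 1,
        Tipping.Xu b c ν < Tipping.Xs b c μ) →
      ∀ Λ, Tipping.IsParameterShift 0 1 Λ → ¬ Tipping.IrreversibleRTipping f 0 1 Λ (S 0)) ∧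
    -- (c)
    ((∀ l ∈ Set.Icc (0 : ℝ) 1, 4 * c l < b l ^ 2) →
      (∃ μ ν : ℝ, 0 < μ ∧ μ < ν ∧ ν < 1 ∧ Tipping.Xs b c μ < Tipping.Xu b c ν) →
      ∃ Λ, Tipping.IsParameterShift 0 1 Λ ∧ Tipping.IrreversibleRTipping f 0 1 Λ (S 0)) ∧
    -- (d)
    ((∀ l ∈ Set.Icc (0 : ℝ) 1, 4 * c l < b l ^ 2) →
      Tipping.Xs b c 0 < Tipping.Xu b c 1 →
      ∃ Λ, Tipping.IsParameterShift 0 1 Λ ∧ Tipping.IrreversibleRTipping f 0 1 Λ (S 0)) ∧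
    -- (e)
    (4 * c 0 < b 0 ^ 2 → (∃ μ : ℝ, 0 < μ ∧ μ < 1 ∧ b μ ^ 2 < 4 * c μ) →
      ∀ Λ, Tipping.IsParameterShift 0 1 Λ → Tipping.BTipping f 0 1 Λ (S 0)) := by
  obtain ⟨f', hm⟩ : ∃ f', Tipping.IsModel b c f f' S := by
    rcases hf with ⟨rfl, rfl⟩ | ⟨rfl, rfl, hpos⟩
    · exact ⟨_, Tipping.isModel_reduced hb hc⟩
    · exact ⟨_, Tipping.isModel_fraedrich ha hτ hb hc hpos⟩
  have h0 : (0 : ℝ) ∈ Set.Icc (0 : ℝ) 1 := ⟨le_rfl, zero_le_one⟩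
  have hreg := hm.toIsRegularField
  refine ⟨fun hD => ⟨hreg.mem_stableEquilibria h0 (hm.zero hD) (hm.deriv_neg hD),
    fun Λ hΛ r hr => ?_⟩, fun hD => ?_, fun hD hUS Λ hΛ => ?_, fun hD hSU => ?_, fun hD hSU => ?_,
    fun hD ⟨μ, hμ0, hμ1, hμ⟩ Λ hΛ => ?_⟩
  · obtain ⟨x, hx⟩ := hreg.exists_pullback hΛ hr (hm.zero hD) (hm.deriv_neg hD)
    exact ⟨x, hx, fun y hy => hreg.pullback_unique hΛ hr (hm.deriv_neg hD) hy hx⟩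
  · obtain ⟨U, p, hbi, -⟩ := hm.exists_isBistable hD
    exact ⟨hbi.isStableBranch, fun Λ hΛ => hbi.not_bTipping hΛ⟩
  · obtain ⟨U, p, hbi, hcmp⟩ := hm.exists_isBistable hD
    exact hbi.not_irreversibleRTipping
      (fun μ hμ ν hν => (hcmp μ hμ ν hν).1 (hUS μ hμ ν hν)) hΛ
  · obtain ⟨U, p, hbi, hcmp⟩ := hm.exists_isBistable hD
    obtain ⟨μ, ν, hμ, hμν, hν, hlt⟩ := hSU
    exact hbi.exists_irreversibleRTipping hμ hμν hν
      ((hcmp μ ⟨hμ.le, (hμν.trans hν).le⟩ ν ⟨(hμ.trans hμν).le, hν.le⟩).2 hlt)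
  · obtain ⟨U, p, hbi, hcmp⟩ := hm.exists_isBistable hD
    obtain ⟨μ, ν, hμ, hμν, hν, hlt⟩ :=
      hbi.exists_lt_of_lt ((hcmp 0 h0 1 ⟨zero_le_one, le_rfl⟩).2 hSU)
    exact hbi.exists_irreversibleRTipping hμ hμν hν hlt
  · obtain ⟨κ, hκ, hev⟩ := hm.exists_eventually_le μ ⟨hμ0, hμ1⟩ hμ
    exact hreg.bTipping hΛ (hm.zero hD) (hm.deriv_neg hD) ⟨hμ0, hμ1⟩ hκ hev
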